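/- **Conventions.** Let $\mathbb K=\mathbb C(q^{1/4})$ and let $U=U_q(\mathfrak{sl}_2)$ be the $\mathbb K$-algebra generated by $E,F$ and $K_{wH/2}$ ($w\in\mathbb Z$; these index the coweight lattice), with $K_0=1$, $K_{x+y}=K_xK_y$, $K_{wH/2}E=q^{w}EK_{wH/2}$, $K_{wH/2}F=q^{-w}FK_{wH/2}$, $EF-FE=\frac{K-K^{-1}}{q-q^{-1}}$, where $K=K_H$. It is a Hopf algebra with $\Delta E=E\otimes K+1\otimes E$, $\Delta F=F\otimes 1+K^{-1}\otimes F$, $\Delta K_x=K_x\otimes K_x$, $\varepsilon(E)=\varepsilon(F)=0$, $\varepsilon(K_x)=1$, $S(E)=-EK^{-1}$, $S(F)=-KF$, $S(K_x)=K_x^{-1}$. A vector $v$ has weight $m\in\mathbb Z$ if $K_{wH/2}v=q^{wm/2}v$ for all $w$; a finite-dimensional representation is of type 1 if it is the sum of its weight spaces. $V_n$ ($n\ge 0$) is the irreducible type 1 representation of highest weight $n$; $V_1$ is the standard representation. $\widetilde U$ and $\widetilde{U\otimes U}$ are the completions of $U$ and $U\otimes U$ in the weak topologies generated by all matrix elements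 of finite-dimensional type 1 representations $V$, respectively of the representations $V\otimes W$ for ordered pairs $(V,W)$ of such; the Hopf algebra operations extend continuously. Define elements of $\widetilde U$ by their action on a vector $v$ of weight $m$ of a finite-dimensional type 1 representation: $Jv=q^{m^2/4+m/2}v$, $$Tv=\sum_{\substack{a,b,c\ge 0\\ b-a-c=m}}(-1)^b q^{\,b-ac}E^{(a)}F^{(b)}E^{(c)}v,\qquad x^{(k)}=\frac{x^k}{[k][k-1]\cdots[1]},\quad [k]=\frac{q^k-q^{-k}}{q-q^{-1}},$$ $X=JT$, and, for $a\in\mathbb K^\times$, $K_av=a^mv$. For invertible $t\in\widetilde U$ put $R_t=(t^{-1}\otimes t^{-1})\Delta(t)$. The standard $R$-matrix is $R=R_X$. The standard ribbon element $C$ is the element of $\widetilde U$ that acts on $V_n$ as the scalar $q^{-n^2/2-n}$ for every $n\ge0$. A topological half-ribbon element for $(U,R)$ is an invertible $t\in\widetilde U$ with $R_t=R$ such that $(U,R_t,t^{-2})$ is a topological ribbon Hopf algebra, that is: $R_t$ is invertible, $R_t\Delta(x)=\Delta^{op}(x)R_t$ for all $x$, $(\Delta\otimes\mathrm{id})R_t=(R_t)_{13}(R_t)_{23}$,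 $(\mathrm{id}\otimes\Delta)R_t=(R_t)_{13}(R_t)_{12}$; and $v=t^{-2}$ is central with $v^2=uS(u)$ for $u=\mu(S\otimes\mathrm{id})(R_t)_{21}$, $S(v)=v$, $\varepsilon(v)=1$, $\Delta(v)=(v\otimes v)\bigl((R_t)_{21}(R_t)_{12}\bigr)^{-1}$. **Theorem.** The element $X$ of $\widetilde U$ is invertible, and the element $C\in\widetilde U$ exists and is unique. There is no topological half-ribbon element $t$ for $(U_q(\mathfrak{sl}_2),R)$ with $t^{-2}=C$. Moreover, every topological half-ribbon element $t$ for $(U_q(\mathfrak{sl}_2),R)$ has the form $t=XK_a$ for some $a\in\mathbb K^\times$ and satisfies $t^{-2}=X^{-2}$, and $X^{-2}$ acts as $-C$ on the standard representation. -/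

import Mathlib

open scoped TensorProduct
noncomputable section
namespace QSl2

/-- The base field `ℂ(q)` with a fourth root of `q` adjoined, i.e. `ℂ(q^{1/4})`. -/
abbrev 𝕂 : Type := RatFunc ℂ
/-- The adjoined fourth root `q^{1/4}` of `q`. -/
def s : 𝕂 := RatFunc.X
def q : 𝕂 := s ^ 4

/-- Generators of `U_q(sl₂)`: `E`, `F`, and `K w` for `w : ℤ`, which stands for `K_{w H/2}`; here
`w H/2` runs over the coweight lattice, and `⟨w H/2, α⟩ = w`. In particular `K_H` is `K 2`. -/
inductive Gen : Type
  | E : Gen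
  | F : Gen
  | K : ℤ → Gen

abbrev gE : FreeAlgebra 𝕂 Gen := FreeAlgebra.ι 𝕂 Gen.E
abbrev gF : FreeAlgebra 𝕂 Gen := FreeAlgebra.ι 𝕂 Gen.F
abbrev gK (w : ℤ) : FreeAlgebra 𝕂 Gen := FreeAlgebra.ι 𝕂 (Gen.K w)

/-- The defining relations of `U_q(sl₂)`. -/
inductive Rel : FreeAlgebra 𝕂 Gen → FreeAlgebra 𝕂 Gen → Prop
  | K_zero : Rel (gK 0) 1
  | K_add (w w' : ℤ) : Rel (gK (w + w')) (gK w * gK w')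
  | K_E (w : ℤ) : Rel (gK w * gE) (q ^ w • (gE * gK w))
  | K_F (w : ℤ) : Rel (gK w * gF) (q ^ (-w) • (gF * gK w))
  | E_F : Rel (gE * gF - gF * gE) ((q - q⁻¹)⁻¹ • (gK 2 - gK (-2)))

/-- The quantized enveloping algebra `U_q(sl₂)`. -/
def Uq : Type := RingQuot Rel

instance : Ring Uq := inferInstanceAs (Ring (RingQuot Rel))
instance : Algebra 𝕂 Uq := inferInstanceAs (Algebra 𝕂 (RingQuot Rel))

/-- The quotient map from the free algebra. -/
def Uq.mk : FreeAlgebra 𝕂 Gen →ₐ[𝕂] Uq := RingQuot.mkAlgHom 𝕂 Rel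

theorem Uq.mk_rel {x y : FreeAlgebra 𝕂 Gen} (h : Rel x y) : Uq.mk x = Uq.mk y :=
  RingQuot.mkAlgHom_rel 𝕂 h

def E : Uq := Uq.mk gE
def F : Uq := Uq.mk gF
def K (w : ℤ) : Uq := Uq.mk (gK w)

theorem K_zero : K 0 = 1 := by
  simpa [K] using Uq.mk_rel Rel.K_zero
theorem K_add (w w' : ℤ) : K (w + w') = K w * K w' := by
  simpa [K] using Uq.mk_rel (Rel.K_add w w')
theorem K_mul_E (w : ℤ) : K w * E = q ^ w • (E * K w) := by
  simpa [K, E] using Uq.mk_rel (Rel.K_E w)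
theorem K_mul_F (w : ℤ) : K w * F = q ^ (-w) • (F * K w) := by
  simpa [K, F] using Uq.mk_rel (Rel.K_F w)
theorem E_mul_F : E * F - F * E = (q - q⁻¹)⁻¹ • (K 2 - K (-2)) := by
  simpa [K, E, F] using Uq.mk_rel Rel.E_F

/-- Auxiliary: a map out of the set of generators. -/
def genMap {A : Type} (e f : A) (k : ℤ → A) : Gen → A
  | Gen.E => e
  | Gen.F => f
  | Gen.K w => k w

/-- The universal property of the presentation. -/
def Uq.lift {A : Type} [Ring A] [Algebra 𝕂 A] (e f : A) (k : ℤ → A) (h0 : k 0 = 1)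
    (hadd : ∀ w w', k (w + w') = k w * k w')
    (hE : ∀ w, k w * e = q ^ w • (e * k w)) (hF : ∀ w, k w * f = q ^ (-w) • (f * k w))
    (hEF : e * f - f * e = (q - q⁻¹)⁻¹ • (k 2 - k (-2))) : Uq →ₐ[𝕂] A :=
  RingQuot.liftAlgHom 𝕂 ⟨FreeAlgebra.lift 𝕂 (genMap e f k), by
    intro x y h
    cases h with
    | K_zero => simpa [genMap] using h0
    | K_add w w' => simpa [genMap] using hadd w w'
    | K_E w => simpa [genMap] using hE w
    | K_F w => simpa [genMap] using hF w
    | E_F => simpa [genMap] using hEF⟩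

theorem Uq.lift_mk {A : Type} [Ring A] [Algebra 𝕂 A] (e f : A) (k : ℤ → A) (h0 hadd hE hF hEF)
    (x : Gen) : Uq.lift e f k h0 hadd hE hF hEF (Uq.mk (FreeAlgebra.ι 𝕂 x)) = genMap e f k x := by
  have := RingQuot.liftAlgHom_mkAlgHom_apply 𝕂 (FreeAlgebra.lift 𝕂 (genMap e f k)) (s := Rel)
    (by
    intro x y h
    cases h with
    | K_zero => simpa [genMap] using h0
    | K_add w w' => simpa [genMap] using hadd w w'
    | K_E w => simpa [genMap] using hE w
    | K_F w => simpa [genMap] using hF w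
    | E_F => simpa [genMap] using hEF) (FreeAlgebra.ι 𝕂 x)
  exact this.trans (FreeAlgebra.lift_ι_apply _ _)

section lift
variable {A : Type} [Ring A] [Algebra 𝕂 A] (e f : A) (k : ℤ → A) (h0 : k 0 = 1)
    (hadd : ∀ w w', k (w + w') = k w * k w')
    (hE : ∀ w, k w * e = q ^ w • (e * k w)) (hF : ∀ w, k w * f = q ^ (-w) • (f * k w))
    (hEF : e * f - f * e = (q - q⁻¹)⁻¹ • (k 2 - k (-2)))
@[simp] theorem lift_E : Uq.lift e f k h0 hadd hE hF hEF E = e := by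
  exact Uq.lift_mk e f k h0 hadd hE hF hEF Gen.E
@[simp] theorem lift_F : Uq.lift e f k h0 hadd hE hF hEF F = f := by
  exact Uq.lift_mk e f k h0 hadd hE hF hEF Gen.F
@[simp] theorem lift_K (w : ℤ) : Uq.lift e f k h0 hadd hE hF hEF (K w) = k w := by
  exact Uq.lift_mk e f k h0 hadd hE hF hEF (Gen.K w)
end lift

theorem s_ne_zero : s ≠ 0 := RatFunc.X_ne_zero
theorem q_ne_zero : q ≠ 0 := pow_ne_zero _ s_ne_zero

/-- The coproduct: `ΔE = E ⊗ K_H + 1 ⊗ E`, `ΔF = F ⊗ 1 + K_H⁻¹ ⊗ F`, `ΔK_w = K_w ⊗ K_w`. -/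
def comul : Uq →ₐ[𝕂] Uq ⊗[𝕂] Uq :=
  Uq.lift (E ⊗ₜ K 2 + 1 ⊗ₜ E) (F ⊗ₜ 1 + K (-2) ⊗ₜ F) (fun w => K w ⊗ₜ K w)
    (by simp [K_zero, Algebra.TensorProduct.one_def])
    (by intro w w'; rw [Algebra.TensorProduct.tmul_mul_tmul, K_add])
    (by
      intro w
      simp only [mul_add, add_mul, Algebra.TensorProduct.tmul_mul_tmul, K_mul_E, smul_add,
        ← K_add, one_mul, mul_one, TensorProduct.smul_tmul', TensorProduct.tmul_smul, add_comm w 2])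
    (by
      intro w
      simp only [mul_add, add_mul, Algebra.TensorProduct.tmul_mul_tmul, K_mul_F, smul_add,
        ← K_add, one_mul, mul_one, TensorProduct.smul_tmul', TensorProduct.tmul_smul,
        add_comm w (-2)])
    (by
      have h1 : (E * K (-2)) ⊗ₜ[𝕂] (K 2 * F) = (K (-2) * E) ⊗ₜ[𝕂] (F * K 2) := by
        rw [K_mul_E, K_mul_F, TensorProduct.tmul_smul, TensorProduct.smul_tmul']
      have h2 : (E * F) ⊗ₜ[𝕂] K 2 - (F * E) ⊗ₜ[𝕂] K 2
          = (q - q⁻¹)⁻¹ • (K 2 ⊗ₜ[𝕂] K 2 - K (-2) ⊗ₜ[𝕂] K 2) := by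
        rw [← TensorProduct.sub_tmul, E_mul_F, ← TensorProduct.sub_tmul, TensorProduct.smul_tmul']
      have h3 : K (-2) ⊗ₜ[𝕂] (E * F) - K (-2) ⊗ₜ[𝕂] (F * E)
          = (q - q⁻¹)⁻¹ • (K (-2) ⊗ₜ[𝕂] K 2 - K (-2) ⊗ₜ[𝕂] K (-2)) := by
        rw [← TensorProduct.tmul_sub, E_mul_F, ← TensorProduct.tmul_sub, TensorProduct.tmul_smul]
      simp only [mul_add, add_mul, Algebra.TensorProduct.tmul_mul_tmul, one_mul, mul_one]
      rw [h1]
      have h4 := congrArg₂ (· + ·) h2 h3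
      simp only [← smul_add] at h4
      rw [show K 2 ⊗ₜ[𝕂] K 2 - K (-2) ⊗ₜ[𝕂] K 2 + (K (-2) ⊗ₜ[𝕂] K 2 - K (-2) ⊗ₜ[𝕂] K (-2))
        = K 2 ⊗ₜ[𝕂] K 2 - K (-2) ⊗ₜ[𝕂] K (-2) by abel] at h4
      rw [← h4]
      abel)

theorem comul_K (w : ℤ) : comul (K w) = K w ⊗ₜ K w :=
  lift_K _ _ _ _ _ _ _ _ w

/-- The counit: `E, F ↦ 0`, `K_w ↦ 1`. -/
def counit : Uq →ₐ[𝕂] 𝕂 :=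
  Uq.lift 0 0 (fun _ => 1) rfl (by simp) (by simp) (by simp) (by simp)

open MulOpposite in
/-- The antipode, as a homomorphism to the opposite algebra: `S(E) = -E K_H⁻¹`, `S(F) = -K_H F`,
`S(K_w) = K_w⁻¹`. -/
def antipode : Uq →ₐ[𝕂] Uqᵐᵒᵖ :=
  Uq.lift (op (-(E * K (-2)))) (op (-(K 2 * F))) (fun w => op (K (-w)))
    (by simp [K_zero])
    (by intro w w'; rw [← op_mul, ← K_add]; congr 2; ring)
    (by
      intro w
      rw [← op_mul, ← op_mul, ← op_smul]
      congr 1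
      rw [neg_mul, mul_neg, mul_assoc, ← K_add, ← mul_assoc, K_mul_E, smul_mul_assoc, mul_assoc,
        ← K_add, smul_neg, smul_smul, ← zpow_add₀ q_ne_zero]
      simp [add_comm])
    (by
      intro w
      rw [← op_mul, ← op_mul, ← op_smul]
      congr 1
      rw [neg_mul, mul_neg, mul_assoc, ← mul_assoc (K (-w)), ← K_add]
      have : F * K (-w) = q ^ (-w) • (K (-w) * F) := by
        rw [K_mul_F, smul_smul, ← zpow_add₀ q_ne_zero]; simp
      rw [this, mul_smul_comm, ← mul_assoc, ← K_add, smul_neg, add_comm])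
    (by
      rw [← op_mul, ← op_mul, ← op_sub, ← op_sub, ← op_smul]
      congr 1
      have h1 : K 2 * F * (E * K (-2)) = F * E := by
        rw [K_mul_F, smul_mul_assoc, mul_assoc, ← mul_assoc (K 2), K_mul_E, smul_mul_assoc,
          mul_assoc, ← K_add, mul_smul_comm, smul_smul, ← zpow_add₀ q_ne_zero]
        simp [K_zero]
      have h2 : E * K (-2) * (K 2 * F) = E * F := by
        rw [mul_assoc, ← mul_assoc (K (-2)), ← K_add]
        simp [K_zero]
      rw [neg_mul_neg, neg_mul_neg, h1, h2, ← neg_sub, E_mul_F, ← smul_neg, neg_sub]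
      simp)

theorem antipode_K (w : ℤ) : antipode (K w) = MulOpposite.op (K (-w)) :=
  lift_K _ _ _ _ _ _ _ _ w

theorem s_zpow_injective : Function.Injective (fun n : ℤ => s ^ n) := by
  intro a b h
  have hdeg : ∀ n : ℕ, RatFunc.intDegree (s ^ n) = n := by
    intro n
    induction n with
    | zero => simp
    | succ n ih =>
      rw [pow_succ, RatFunc.intDegree_mul (pow_ne_zero _ s_ne_zero) s_ne_zero, ih]
      simp [s]
  have key : ∀ n : ℤ, RatFunc.intDegree (s ^ n) = n := by
    intro n
    obtain ⟨m, rfl | rfl⟩ := n.eq_nat_or_neg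
    · rw [zpow_natCast, hdeg]
    · rw [zpow_neg, RatFunc.intDegree_inv, zpow_natCast, hdeg]
  rw [← key a, ← key b]
  exact congrArg RatFunc.intDegree h

/-- The weight space of weight `m` (that is, `m` times the fundamental weight `ω`):
`K_{w H/2}` acts by `q^{⟨w H/2, m ω⟩} = q^{w m / 2}`. -/
def weightSpace {V : Type} [AddCommGroup V] [Module 𝕂 V] (ρ : Uq →ₐ[𝕂] Module.End 𝕂 V) (m : ℤ) :
    Submodule 𝕂 V where
  carrier := {v | ∀ w : ℤ, ρ (K w) v = s ^ (2 * w * m) • v}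
  add_mem' := by
    intro a b ha hb w
    rw [map_add, ha w, hb w, smul_add]
  zero_mem' := by intro w; simp
  smul_mem' := by
    intro c v hv w
    rw [map_smul, hv w, smul_comm]

/-- Finite-dimensional type 1 representations of `U_q(sl₂)`: those that are the sum of their weight
spaces. -/
structure Rep where
  V : Type
  [addCommGroup : AddCommGroup V]
  [module : Module 𝕂 V]
  [finite : Module.Finite 𝕂 V]
  ρ : Uq →ₐ[𝕂] Module.End 𝕂 V
  type_one : ⨆ m : ℤ, weightSpace ρ m = ⊤

attribute [instance] Rep.addCommGroup Rep.module Rep.finite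

namespace Rep

variable (V W : Rep)

abbrev wt (m : ℤ) : Submodule 𝕂 V.V := weightSpace V.ρ m

theorem ext_wt {V : Rep} {M : Type} [AddCommGroup M] [Module 𝕂 M] {f g : V.V →ₗ[𝕂] M}
    (h : ∀ m, ∀ v ∈ V.wt m, f v = g v) : f = g := by
  have : (⊤ : Submodule 𝕂 V.V) ≤ LinearMap.eqLocus f g := by
    rw [← V.type_one]
    exact iSup_le fun m v hv => h m v hv
  exact LinearMap.ext fun v => this trivial

theorem two_mul_injective : Function.Injective (fun m : ℤ => s ^ (2 * m)) := by
  intro a b h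
  have := s_zpow_injective h
  omega

theorem wt_le_eigenspace (m : ℤ) :
    V.wt m ≤ Module.End.eigenspace (V.ρ (K 1)) (s ^ (2 * m)) := by
  intro v hv
  rw [Module.End.mem_eigenspace_iff, hv 1]
  simp

theorem finite_weights : {m : ℤ | V.wt m ≠ ⊥}.Finite := by
  apply WellFoundedGT.finite_ne_bot_of_iSupIndep
  exact ((Module.End.eigenspaces_iSupIndep (V.ρ (K 1))).comp two_mul_injective).mono
    V.wt_le_eigenspace

/-- On finitely many representations, any function of the weight is realized by an element of
`U_q(sl₂)`. -/
theorem exists_interp (S : Finset Rep) (f : ℤ → 𝕂) :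
    ∃ x : Uq, ∀ V ∈ S, ∀ m, ∀ v ∈ V.wt m, V.ρ x v = f m • v := by
  classical
  have hfin : (⋃ V ∈ S, {m : ℤ | V.wt m ≠ ⊥}).Finite :=
    S.finite_toSet.biUnion fun V _ => V.finite_weights
  let p := Lagrange.interpolate hfin.toFinset (fun m : ℤ => s ^ (2 * m)) f
  refine ⟨Polynomial.aeval (K 1) p, fun V hV m v hv => ?_⟩
  by_cases hv0 : v = 0
  · simp [hv0]
  have hm : m ∈ hfin.toFinset := by
    rw [Set.Finite.mem_toFinset, Set.mem_iUnion₂]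
    exact ⟨V, hV, fun h => hv0 (by simpa [h] using hv)⟩
  rw [← Polynomial.aeval_algHom_apply,
    Module.End.aeval_apply_of_hasEigenvector ⟨V.wt_le_eigenspace m hv, hv0⟩,
    Lagrange.eval_interpolate_at_node _ two_mul_injective.injOn hm]

theorem E_mem {V : Rep} {m : ℤ} {v : V.V} (hv : v ∈ V.wt m) : V.ρ E v ∈ V.wt (m + 2) := by
  intro w
  rw [← Module.End.mul_apply, ← map_mul, K_mul_E, map_smul, map_mul, LinearMap.smul_apply,
    Module.End.mul_apply, hv w, map_smul, smul_smul, q, ← zpow_natCast, ← zpow_mul,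
    ← zpow_add₀ s_ne_zero]
  congr 2; push_cast; ring

theorem F_mem {V : Rep} {m : ℤ} {v : V.V} (hv : v ∈ V.wt m) : V.ρ F v ∈ V.wt (m - 2) := by
  intro w
  rw [← Module.End.mul_apply, ← map_mul, K_mul_F, map_smul, map_mul, LinearMap.smul_apply,
    Module.End.mul_apply, hv w, map_smul, smul_smul, q, ← zpow_natCast, ← zpow_mul,
    ← zpow_add₀ s_ne_zero]
  congr 2; push_cast; ring

theorem pow_finrank_eq_zero (x : Uq) (d : ℤ) (hd : d ≠ 0)
    (hx : ∀ m, ∀ v ∈ V.wt m, V.ρ x v ∈ V.wt (m + d)) :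
    V.ρ x ^ Module.finrank 𝕂 V.V = 0 := by
  have hpow : ∀ k : ℕ, ∀ m, ∀ v ∈ V.wt m, (V.ρ x ^ k) v ∈ V.wt (m + k * d) := by
    intro k
    induction k with
    | zero => intro m v hv; simpa using hv
    | succ k ih =>
      intro m v hv
      rw [pow_succ', Module.End.mul_apply]
      have := hx _ _ (ih m v hv)
      convert this using 2
      push_cast; ring
  have key : ∀ v : V.V, ∃ k : ℕ, (V.ρ x ^ k) v = 0 := by
    have hsub : ∀ m, ∀ v ∈ V.wt m, ∃ k : ℕ, (V.ρ x ^ k) v = 0 := by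
      intro m v hv
      by_contra! hne
      refine Set.infinite_of_injective_forall_mem (f := fun k : ℕ => m + k * d) ?_ ?_
        V.finite_weights
      · intro a b hab
        have : (a : ℤ) * d = b * d := by simpa using hab
        exact_mod_cast mul_right_cancel₀ hd this
      · intro k h
        have := hpow k m v hv
        rw [h] at this
        exact hne k (by simpa using this)
    intro v
    have hv : v ∈ ⨆ m : ℤ, V.wt m := by rw [V.type_one]; trivial
    induction hv using Submodule.iSup_induction' with
    | mem m v hv => exact hsub m v hv
    | zero => exact ⟨0, by simp⟩
    | add u v _ _ hu hv =>
      obtain ⟨k, hk⟩ := hu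
      obtain ⟨l, hl⟩ := hv
      refine ⟨l + k, ?_⟩
      rw [map_add, pow_add, Module.End.mul_apply, hk, map_zero, zero_add, ← pow_add, add_comm l k,
        pow_add, Module.End.mul_apply, hl, map_zero]
  ext v
  obtain ⟨k, hk⟩ := key v
  exact Module.End.ker_pow_le_ker_pow_finrank (V.ρ x) k hk

theorem E_pow_eq_zero {n : ℕ} (hn : Module.finrank 𝕂 V.V ≤ n) : V.ρ E ^ n = 0 :=
  pow_eq_zero_of_le hn (V.pow_finrank_eq_zero E 2 (by norm_num) fun _ _ hv => E_mem hv)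

theorem F_pow_eq_zero {n : ℕ} (hn : Module.finrank 𝕂 V.V ≤ n) : V.ρ F ^ n = 0 :=
  pow_eq_zero_of_le hn (V.pow_finrank_eq_zero F (-2) (by norm_num) fun _ _ hv => F_mem hv)

/-- The action of `U ⊗ U` on `V ⊗ W`. -/
abbrev act₂ : Uq ⊗[𝕂] Uq →ₐ[𝕂] Module.End 𝕂 (V.V ⊗[𝕂] W.V) :=
  (Module.endTensorEndAlgHom (A := 𝕂)).comp (Algebra.TensorProduct.map V.ρ W.ρ)

theorem act₂_tmul (x y : Uq) : act₂ V W (x ⊗ₜ y) = TensorProduct.map (V.ρ x) (W.ρ y) := by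
  rfl

/-- The tensor product of representations, through the coproduct. -/
abbrev tensor : Rep where
  V := V.V ⊗[𝕂] W.V
  ρ := (act₂ V W).comp comul
  type_one := by
    rw [eq_top_iff, ← TensorProduct.map₂_mk_top_top_eq_top, ← V.type_one, ← W.type_one,
      Submodule.map₂_iSup_left]
    refine iSup_le fun m => ?_
    rw [Submodule.map₂_iSup_right]
    refine iSup_le fun n => le_trans ?_ (le_iSup _ (m + n))
    rw [Submodule.map₂_le]
    intro v hv x hx w
    rw [AlgHom.comp_apply, comul_K, act₂_tmul]
    simp only [TensorProduct.mk_apply, TensorProduct.map_tmul]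
    rw [hv w, hx w, TensorProduct.smul_tmul_smul, ← zpow_add₀ s_ne_zero]
    congr 2; ring

/-- The trivial representation, through the counit. -/
abbrev triv : Rep where
  V := 𝕂
  ρ := (Algebra.lmul 𝕂 𝕂).comp counit
  type_one := by
    rw [eq_top_iff]
    refine le_trans ?_ (le_iSup _ 0)
    intro v _ w
    simp [counit]

/-- Transposition of endomorphisms, as an anti-homomorphism. -/
def transposeHom (M : Type) [AddCommGroup M] [Module 𝕂 M] :
    (Module.End 𝕂 M)ᵐᵒᵖ →ₐ[𝕂] Module.End 𝕂 (Module.Dual 𝕂 M) where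
  toFun f := f.unop.dualMap
  map_one' := rfl
  map_mul' _ _ := rfl
  map_zero' := by ext; simp
  map_add' _ _ := by ext; simp
  commutes' _ := by ext; simp [Algebra.algebraMap_eq_smul_one]

/-- The left dual representation: `(x • f)(v) = f (S(x) v)`. -/
abbrev dual : Rep where
  V := Module.Dual 𝕂 V.V
  ρ := (transposeHom V.V).comp ((AlgHom.op V.ρ).comp antipode)
  type_one := by
    rw [eq_top_iff]
    intro f _
    classical
    choose P hP using fun m : ℤ => exists_interp {V} (Pi.single m 1)
    have hf : f = ∑ m ∈ V.finite_weights.toFinset, f ∘ₗ V.ρ (P m) := by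
      apply ext_wt
      intro m v hv
      by_cases h0 : v = 0
      · simp [h0]
      rw [LinearMap.sum_apply, Finset.sum_eq_single m]
      · simp [hP m V (by simp) m v hv]
      · intro n _ hn
        simp [hP n V (by simp) m v hv, hn.symm]
      · intro hm
        exfalso
        apply hm
        rw [Set.Finite.mem_toFinset]
        exact fun h => h0 (by simpa [h] using hv)
    rw [hf]
    refine Submodule.sum_mem _ fun m _ => Submodule.mem_iSup_of_mem (-m) ?_
    intro w
    apply ext_wt
    intro n v hv
    have : ((transposeHom V.V).comp ((AlgHom.op V.ρ).comp antipode)) (K w) (f ∘ₗ V.ρ (P m)) v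
        = f (V.ρ (P m) (V.ρ (K (-w)) v)) := by
      simp only [AlgHom.comp_apply, antipode_K]
      rfl
    rw [this, hv, map_smul, hP m V (by simp) n v hv]
    by_cases hmn : n = m
    · subst hmn
      simp [hP n V (by simp) n v hv]
    · simp [hP m V (by simp) n v hv, hmn]


theorem std_E_F : (!![0, 1; 0, 0] : Matrix (Fin 2) (Fin 2) 𝕂) * !![0, 0; 1, 0]
    - !![0, 0; 1, 0] * !![0, 1; 0, 0] =
    (q - q⁻¹)⁻¹ • (!![s ^ (2 * (2 : ℤ)), 0; 0, s ^ (-(2 * (2 : ℤ)))]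
      - !![s ^ (2 * (-2 : ℤ)), 0; 0, s ^ (-(2 * (-2 : ℤ)))]) := by
  have h1 : s ^ (2 * (2 : ℤ)) = q := by rw [q, ← zpow_natCast]; norm_num
  have h2 : s ^ (-(2 * (2 : ℤ))) = q⁻¹ := by rw [zpow_neg, h1]
  have h3 : s ^ (2 * (-2 : ℤ)) = q⁻¹ := by rw [← h2]; norm_num
  have h4 : s ^ (-(2 * (-2 : ℤ))) = q := by rw [← h1]; norm_num
  have h5 : q - q⁻¹ ≠ 0 := by
    rw [← h2, ← h1, sub_ne_zero]
    intro h
    have := s_zpow_injective h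
    omega
  rw [h1, h2, h3, h4]
  have h6 : (q - q⁻¹)⁻¹ * (q⁻¹ - q) = -1 := by
    rw [← neg_sub q, mul_neg, inv_mul_cancel₀ h5]
  ext i j
  fin_cases i <;> fin_cases j <;>
    simp [inv_mul_cancel₀ h5, h6]

/-- The standard representation, with basis `v₊, v₋`: `E v₋ = v₊`, `F v₊ = v₋`,
`K_H v₊ = q v₊`, `K_H v₋ = q⁻¹ v₋`. -/
abbrev std : Rep where
  V := Fin 2 → 𝕂
  ρ := (Matrix.toLinAlgEquiv' (R := 𝕂) (n := Fin 2)).toAlgHom.comp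
    (Uq.lift !![0, 1; 0, 0] !![0, 0; 1, 0] (fun w => !![s ^ (2 * w), 0; 0, s ^ (-(2 * w))])
      (by
        ext i j
        fin_cases i <;> fin_cases j <;> simp)
      (by
        intro w w'
        ext i j
        fin_cases i <;> fin_cases j <;>
          simp only [Matrix.mul_apply, Fin.sum_univ_two, mul_add, neg_add, zpow_add₀ s_ne_zero] <;>
          simp)
      (by
        intro w
        have h : s ^ (2 * w) = q ^ w * s ^ (-(2 * w)) := by
          rw [q, ← zpow_natCast, ← zpow_mul, ← zpow_add₀ s_ne_zero]
          congr 1; push_cast; ring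
        ext i j
        fin_cases i <;> fin_cases j <;>
          simp only [Matrix.mul_apply, Fin.sum_univ_two, Matrix.smul_apply, h] <;> simp)
      (by
        intro w
        have h : s ^ (-(2 * w)) = q ^ (-w) * s ^ (2 * w) := by
          rw [q, ← zpow_natCast, ← zpow_mul, ← zpow_add₀ s_ne_zero]
          congr 1; push_cast; ring
        ext i j
        fin_cases i <;> fin_cases j <;>
          simp only [Matrix.mul_apply, Fin.sum_univ_two, Matrix.smul_apply, h] <;> simp)
      std_E_F)
  type_one := by
    rw [eq_top_iff]
    intro v _
    have hv : v = Pi.single 0 (v 0) + Pi.single 1 (v 1) := by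
      ext i; fin_cases i <;> simp
    rw [hv]
    refine Submodule.add_mem _ (Submodule.mem_iSup_of_mem 1 ?_) (Submodule.mem_iSup_of_mem (-1) ?_)
    · intro w
      rw [AlgHom.comp_apply, lift_K]
      ext i
      fin_cases i <;> simp [Matrix.toLinAlgEquiv'_apply, Matrix.mulVec, dotProduct, Fin.sum_univ_two]
    · intro w
      rw [AlgHom.comp_apply, lift_K]
      ext i
      fin_cases i <;> simp [Matrix.toLinAlgEquiv'_apply, Matrix.mulVec, dotProduct, Fin.sum_univ_two]

end Rep

/-- Families of endomorphisms, one of each finite-dimensional type 1 representation. The product of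
these (discrete) endomorphism rings receives `U_q(sl₂)`, and the weak topology generated by the
matrix elements is the one induced from it. -/
abbrev Fam : Type 1 := ∀ V : Rep, Module.End 𝕂 V.V

/-- Families of endomorphisms of `V ⊗ W`, one for each ordered pair of representations. -/
abbrev Fam₂ : Type 1 := ∀ V W : Rep, Module.End 𝕂 (V.V ⊗[𝕂] W.V)

/-- The completion of `U_q(sl₂)` in the weak topology generated by all matrix elements of all
finite-dimensional type 1 representations. This is the closure of the image of `U_q(sl₂)` in the
product of the discrete rings `End V`: a family belongs to it iff on every finite set of
representations it agrees with an element of `U_q(sl₂)`. -/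
def completion : Subalgebra 𝕂 Fam where
  carrier := {a | ∀ S : Finset Rep, ∃ x : Uq, ∀ V ∈ S, a V = V.ρ x}
  mul_mem' := by
    intro a b ha hb S
    obtain ⟨x, hx⟩ := ha S
    obtain ⟨y, hy⟩ := hb S
    exact ⟨x * y, fun V hV => by rw [Pi.mul_apply, hx V hV, hy V hV, map_mul]⟩
  add_mem' := by
    intro a b ha hb S
    obtain ⟨x, hx⟩ := ha S
    obtain ⟨y, hy⟩ := hb S
    exact ⟨x + y, fun V hV => by rw [Pi.add_apply, hx V hV, hy V hV, map_add]⟩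
  algebraMap_mem' := by
    intro r S
    exact ⟨algebraMap 𝕂 Uq r, fun V _ => by rw [AlgHom.commutes]; rfl⟩

/-- The completion of `U_q(sl₂) ⊗ U_q(sl₂)` in the weak topology generated by all matrix elements
of the representations `V ⊗ W`, for ordered pairs `(V, W)`. -/
def completion₂ : Subalgebra 𝕂 Fam₂ where
  carrier := {R | ∀ S : Finset (Rep × Rep), ∃ z : Uq ⊗[𝕂] Uq, ∀ p ∈ S,
    R p.1 p.2 = Rep.act₂ p.1 p.2 z}
  mul_mem' := by
    intro a b ha hb S
    obtain ⟨x, hx⟩ := ha S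
    obtain ⟨y, hy⟩ := hb S
    exact ⟨x * y, fun V hV => by rw [Pi.mul_apply, Pi.mul_apply, hx V hV, hy V hV, map_mul]⟩
  add_mem' := by
    intro a b ha hb S
    obtain ⟨x, hx⟩ := ha S
    obtain ⟨y, hy⟩ := hb S
    exact ⟨x + y, fun V hV => by rw [Pi.add_apply, Pi.add_apply, hx V hV, hy V hV, map_add]⟩
  algebraMap_mem' := by
    intro r S
    exact ⟨algebraMap 𝕂 _ r, fun p _ => by rw [AlgHom.commutes]; rfl⟩

/-- The continuous extension of the coproduct: `Δ(a)` acts on `V ⊗ W` as `a` acts on the tensor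
product representation. -/
def comulHat (a : completion) : completion₂ :=
  ⟨fun V W => a.1 (V.tensor W), by
    classical
    intro S
    obtain ⟨x, hx⟩ := a.2 (S.image fun p => p.1.tensor p.2)
    exact ⟨comul x, fun p hp => hx _ (Finset.mem_image_of_mem _ hp)⟩⟩

/-- The element `a ⊗ b`. -/
def tmulHat (a b : completion) : completion₂ :=
  ⟨fun V W => TensorProduct.map (a.1 V) (b.1 W), by
    classical
    intro S
    obtain ⟨x, hx⟩ := a.2 (S.image Prod.fst)
    obtain ⟨y, hy⟩ := b.2 (S.image Prod.snd)
    refine ⟨x ⊗ₜ y, fun p hp => ?_⟩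
    dsimp only
    rw [Rep.act₂_tmul, hx _ (Finset.mem_image_of_mem _ hp), hy _ (Finset.mem_image_of_mem _ hp)]⟩

/-- `R ↦ R₂₁`. -/
def flip₂ (R : Fam₂) : Fam₂ := fun V W =>
  (TensorProduct.comm 𝕂 W.V V.V).conj (R W V)

/-- The continuous extension of the counit: the action on the trivial representation. -/
def counitHat (a : Fam) : Module.End 𝕂 𝕂 := a Rep.triv

/-- The continuous extension of the antipode: `S(a)` acts on `V` as the transpose of the action of
`a` on `V^*`. -/
def antipodeHat (a : Fam) : Fam := fun V =>
  (Module.evalEquiv 𝕂 V.V).symm.conj (LinearMap.dualMap (a V.dual))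

/-- The continuous extension of `a ⊗ b ↦ S(b) a = μ (S ⊗ id) (b ⊗ a)`; its value at `R` is the
element `u = μ (S ⊗ id) R₂₁`. It is characterized by `f (u v) = ev (R (v ⊗ f))` for `v ∈ V`,
`f ∈ V^*`. -/
def drinfeld (R : Fam₂) : Fam := fun V =>
  (Module.evalEquiv 𝕂 V.V).symm.toLinearMap ∘ₗ
    TensorProduct.curry (contractRight 𝕂 V.V ∘ₗ R V V.dual)

section legs
variable (R : Fam₂) (V W Z : Rep)

/-- Endomorphisms of a triple tensor product. -/
abbrev End₃ : Type := Module.End 𝕂 ((V.V ⊗[𝕂] W.V) ⊗[𝕂] Z.V)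

/-- `R₁₂` on `V ⊗ W ⊗ Z`. -/
def leg₁₂ : End₃ V W Z := TensorProduct.map (R V W) LinearMap.id

/-- `R₂₃` on `V ⊗ W ⊗ Z`. -/
def leg₂₃ : End₃ V W Z :=
  (TensorProduct.assoc 𝕂 V.V W.V Z.V).symm.conj (TensorProduct.map LinearMap.id (R W Z))

/-- `R₁₃` on `V ⊗ W ⊗ Z`. -/
def leg₁₃ : End₃ V W Z :=
  (TensorProduct.rightComm 𝕂 V.V Z.V W.V).conj (TensorProduct.map (R V Z) LinearMap.id)

/-- `(Δ ⊗ id) R` on `V ⊗ W ⊗ Z`. -/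
def comulLeft : End₃ V W Z := R (V.tensor W) Z

/-- `(id ⊗ Δ) R` on `V ⊗ W ⊗ Z`. -/
def comulRight : End₃ V W Z :=
  (TensorProduct.assoc 𝕂 V.V W.V Z.V).symm.conj (R V (W.tensor Z))

end legs

/-- `(U_q(sl₂), R)` is a topological quasi-triangular Hopf algebra: `R` is invertible,
`R Δ(a) = Δᵒᵖ(a) R`, `(Δ ⊗ id) R = R₁₃ R₂₃`, `(id ⊗ Δ) R = R₁₃ R₁₂`. -/
structure IsQuasitriangular (R : completion₂) : Prop where
  isUnit : IsUnit R
  comul_op : ∀ a : completion, R.1 * (comulHat a).1 = flip₂ (comulHat a).1 * R.1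
  comul_left : ∀ V W Z : Rep, comulLeft R.1 V W Z = leg₁₃ R.1 V W Z * leg₂₃ R.1 V W Z
  comul_right : ∀ V W Z : Rep, comulRight R.1 V W Z = leg₁₃ R.1 V W Z * leg₁₂ R.1 V W Z

/-- `(U_q(sl₂), R, v)` is a topological ribbon Hopf algebra: `v` is invertible and central,
`v² = u S(u)`, `S(v) = v`, `ε(v) = 1`, and `Δ(v) = (v ⊗ v)(R₂₁ R₁₂)⁻¹`; as `R` is invertible the
last identity is written without inverses. -/
structure IsRibbon (R : completion₂) (v : completionˣ) : Prop where
  quasitriangular : IsQuasitriangular R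
  central : ∀ a : completion, (v : completion) * a = a * v
  sq : (v : completion).1 ^ 2 = drinfeld R.1 * antipodeHat (drinfeld R.1)
  antipode : antipodeHat (v : completion).1 = (v : completion).1
  counit : counitHat (v : completion).1 = 1
  comul : (comulHat v).1 * (flip₂ R.1 * R.1) = (tmulHat v v).1

/-- `(t⁻¹ ⊗ t⁻¹) Δ(t)`. -/
def rMatrix (t : completionˣ) : completion₂ := tmulHat ↑t⁻¹ ↑t⁻¹ * comulHat t

/-- `t` is a topological half-ribbon element for `(U_q(sl₂), R)`: the triple
`(U_q(sl₂), (t⁻¹ ⊗ t⁻¹) Δ(t), t⁻²)` is a topological ribbon Hopf algebra, and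
`(t⁻¹ ⊗ t⁻¹) Δ(t) = R`. -/
structure IsHalfRibbon (R : completion₂) (t : completionˣ) : Prop where
  ribbon : IsRibbon (rMatrix t) (t⁻¹ ^ 2)
  rMatrix_eq : rMatrix t = R

/-- The element of the completion that acts on vectors of weight `m` by the scalar `f m`. -/
def weightDiag (f : ℤ → 𝕂) : completion :=
  ⟨fun V => V.ρ (Classical.choose (Rep.exists_interp {V} f)), by
    intro S
    obtain ⟨x, hx⟩ := Rep.exists_interp S f
    refine ⟨x, fun V hV => Rep.ext_wt fun m v hv => ?_⟩
    rw [hx V hV m v hv,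
      Classical.choose_spec (Rep.exists_interp {V} f) V (Finset.mem_singleton_self V) m v hv]⟩

theorem weightDiag_apply (f : ℤ → 𝕂) (V : Rep) (m : ℤ) (v : V.V) (hv : v ∈ V.wt m) :
    (weightDiag f).1 V v = f m • v :=
  Classical.choose_spec (Rep.exists_interp {V} f) V (Finset.mem_singleton_self V) m v hv

/-- The element `K_a`, acting on vectors of weight `m` by `a ^ m`. -/
def Ktwist (a : 𝕂ˣ) : completion := weightDiag fun m => ((a ^ m : 𝕂ˣ) : 𝕂)

/-- The element `J`, acting on vectors of weight `μ = m ω` by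
`q^{(μ, μ)/2 + (μ, ρ)} = q^{m²/4 + m/2}`. -/
def J : completion := weightDiag fun m => s ^ (m ^ 2 + 2 * m)

/-- The quantum integer `[n]`. -/
def qInt (n : ℕ) : 𝕂 := (q ^ n - (q ^ n)⁻¹) / (q - q⁻¹)

/-- The quantum factorial `[n] ⋯ [1]`. -/
def qFactorial (n : ℕ) : 𝕂 := ∏ k ∈ Finset.range n, qInt (k + 1)

/-- The divided power `x^{(n)}`. -/
def divPow (x : Uq) (n : ℕ) : Uq := (qFactorial n)⁻¹ • x ^ n

/-- `(-1)^b q^{b - ac} E^{(a)} F^{(b)} E^{(c)}`. -/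
def braidTerm (a b c : ℕ) : Uq :=
  ((-1) ^ b * q ^ ((b : ℤ) - a * c)) • (divPow E a * divPow F b * divPow E c)

theorem braidTerm_eq_zero (V : Rep) (N a b c : ℕ) (hN : Module.finrank 𝕂 V.V ≤ N)
    (h : N ≤ a ∨ N ≤ b ∨ N ≤ c) : V.ρ (braidTerm a b c) = 0 := by
  rw [braidTerm, divPow, divPow, divPow]
  simp only [map_smul, map_mul, map_pow]
  rcases h with h | h | h
  · simp [V.E_pow_eq_zero (hN.trans h)]
  · simp [V.F_pow_eq_zero (hN.trans h)]
  · simp [V.E_pow_eq_zero (hN.trans h)]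

/-- The projection onto the weight space of weight `m`. -/
def weightProj (m : ℤ) : completion := weightDiag (Pi.single m 1)

/-- The quantum Weyl group element, acting on a vector `v` of weight `m` by
`T v = ∑ (-1)^b q^{b - ac} E^{(a)} F^{(b)} E^{(c)} v`, summed over `a, b, c ≥ 0` with
`b - a - c = m`. On each representation only finitely many terms are non-zero, since `E` and `F`
act nilpotently. -/
def T : completion :=
  ⟨fun V => ∑ᶠ p : ℕ × ℕ × ℕ, V.ρ (braidTerm p.1 p.2.1 p.2.2) *
      (weightProj ((p.2.1 : ℤ) - p.1 - p.2.2)).1 V, by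
    classical
    intro S
    obtain ⟨N, hN⟩ : ∃ N, ∀ V ∈ S, Module.finrank 𝕂 V.V ≤ N :=
      ⟨S.sup fun V => Module.finrank 𝕂 V.V, fun V hV =>
        Finset.le_sup (f := fun V : Rep => Module.finrank 𝕂 V.V) hV⟩
    choose P hP using fun m => (weightProj m).2 S
    let B : Finset (ℕ × ℕ × ℕ) := Finset.range N ×ˢ Finset.range N ×ˢ Finset.range N
    refine ⟨∑ p ∈ B, braidTerm p.1 p.2.1 p.2.2 * P ((p.2.1 : ℤ) - p.1 - p.2.2), fun V hV => ?_⟩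
    dsimp only
    rw [map_sum, finsum_eq_sum_of_support_subset (s := B)]
    · exact Finset.sum_congr rfl fun p _ => by rw [map_mul, hP _ V hV]
    · intro p hp
      by_contra hB
      apply hp
      simp only [B, Finset.coe_product, Set.mem_prod, Finset.mem_coe, Finset.mem_range] at hB
      dsimp only
      rw [braidTerm_eq_zero V N _ _ _ (hN V hV) (by omega), zero_mul]⟩

/-- The element `X = J T`. -/
def X : completion := J * T

/-- `V` is the irreducible representation `V_λ` with highest weight `λ = n ω`. -/
structure IsIrreducibleOfHighestWeight (V : Rep) (n : ℕ) : Prop where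
  irreducible : ∀ W : Submodule 𝕂 V.V, (∀ x : Uq, ∀ w ∈ W, V.ρ x w ∈ W) → W = ⊥ ∨ W = ⊤
  highest : ∃ v ∈ V.wt n, v ≠ 0 ∧ V.ρ E v = 0

/-- `c` acts on each `V_λ`, `λ = n ω`, as `q^{-(λ, λ) - 2(λ, ρ)} = q^{-n²/2 - n}`. -/
def IsStandardRibbonElement (c : completion) : Prop :=
  ∀ (n : ℕ) (V : Rep), IsIrreducibleOfHighestWeight V n →
    c.1 V = s ^ (-(2 * (n : ℤ) ^ 2 + 4 * n)) • 1

end QSl2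

end

noncomputable section
namespace QSl2

/-! The obstruction is a sign on the standard representation `V₁`. Let `t` be half-ribbon for `R =
R_X` and put `g = X⁻¹t`. Equality of the two R-matrices says `(g ⊗ g) R = R Δ(g)`, and `R Δ(g) =
Δᵒᵖ(g) R` with `R` invertible gives `Δᵒᵖ(g) = g ⊗ g`, so `g` is group-like
(`grouplike_of_rMatrix_eq`). These properties of `R` need no separate proof: they are part of the
assumption that `t` is half-ribbon.

A group-like unit acts as 1 on the trivial representation, hence fixes the invariant vector of `V₁ ⊗
V₁`. Comparing coefficients there forces `g` to be diagonal on `V₁` with mutually inverse entries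
`α`, `α⁻¹`. Being multiplicative on tensor products, `g` agrees with `K_α` on all tensor powers of
`V₁`, hence everywhere (`eq_Ktwist_of_grouplike`). Since `X` sends weight `m` to weight `-m`, `X K_a
= K_a⁻¹ X`, so `(X K_a)² = X²` and `t⁻² = X⁻²`. On `V₁` the square of `X` is `-q^{3/2}`, whereas `C`
is `q^{-3/2}`; the signs disagree.

Two further facts carry this. Elements of the completion are determined by representations
containing highest weight vectors of every weight (`completion_ext`); this rests on the Casimir
element, whose eigenvectors span every representation. And `T` is invertible: in its triple sum only
the terms with `c = 0` survive (`Rep.T_apply`), and the intertwining rule `T E v = -q^{-m} F T v`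
carries lowest weight strings onto highest weight strings (`Rep.T_injective`). -/

/-! ### Quantum integers and Casimir eigenvalues. -/

theorem q_zpow (m : ℤ) : q ^ m = s ^ (4 * m) := by
  rw [q, ← zpow_natCast, ← zpow_mul]; rfl

theorem q_zpow_injective : Function.Injective (fun n : ℤ => q ^ n) := by
  intro a b h
  simp only [q_zpow] at h
  have := s_zpow_injective h
  omega

theorem q_sub_ne_zero : q - q⁻¹ ≠ 0 := by
  rw [sub_ne_zero]
  intro h
  have := @q_zpow_injective 1 (-1) (by simpa using h)
  omega

/-- The quantum integer `[m]` for `m : ℤ`. -/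
def qz (m : ℤ) : 𝕂 := (q ^ m - q ^ (-m)) / (q - q⁻¹)

theorem qz_natCast (n : ℕ) : qz n = qInt n := by
  simp [qz, qInt]

theorem qz_ne_zero {m : ℤ} (hm : m ≠ 0) : qz m ≠ 0 := by
  refine div_ne_zero (sub_ne_zero.2 fun h => ?_) q_sub_ne_zero
  have := q_zpow_injective h
  omega

@[simp] theorem qz_zero : qz 0 = 0 := by simp [qz]
@[simp] theorem qz_one : qz 1 = 1 := by simp [qz, div_self q_sub_ne_zero]

/-- The eigenvalue of the Casimir element on a highest weight vector of weight `m`. -/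
def chi (m : ℤ) : 𝕂 := (q ^ (m + 1) + q ^ (-(m + 1))) / (q - q⁻¹) ^ 2

/-- With `a = q^{m+1}` and `b = q^{n+1}`, equality means `a + a⁻¹ = b + b⁻¹`, that is `(a - b)(1 -
(ab)⁻¹) = 0`; `q` is not a root of unity. This is central character separation up to the shifted
Weyl reflection. -/
theorem chi_eq_iff {m n : ℤ} : chi m = chi n ↔ m = n ∨ m = -n - 2 := by
  constructor
  · intro h
    rw [chi, chi, div_left_inj' (pow_ne_zero 2 q_sub_ne_zero)] at h
    have h2 : (q ^ (m + 1) - q ^ (n + 1)) * (1 - q ^ (-(m + 1) + -(n + 1))) = 0 := by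
      have ha : q ^ (m + 1) * q ^ (-(m + 1)) = 1 := by
        rw [← zpow_add₀ q_ne_zero]; simp
      have hb : q ^ (n + 1) * q ^ (-(n + 1)) = 1 := by
        rw [← zpow_add₀ q_ne_zero]; simp
      rw [zpow_add₀ q_ne_zero (-(m + 1))]
      generalize q ^ (m + 1) = a at *
      generalize q ^ (n + 1) = b at *
      generalize q ^ (-(m + 1)) = c at *
      generalize q ^ (-(n + 1)) = d at *
      linear_combination h - d * ha + c * hb
    rcases mul_eq_zero.1 h2 with h | h
    · left
      have := q_zpow_injective (sub_eq_zero.1 h)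
      omega
    · right
      have := @q_zpow_injective 0 (-(m + 1) + -(n + 1)) (by simpa using sub_eq_zero.1 h)
      omega
  · rintro (rfl | rfl)
    · rfl
    · rw [chi, chi, add_comm]
      congr 3 <;> ring

theorem chi_sub_chi (m : ℤ) : chi m - chi (m - 2) = qz m := by
  have hq := q_sub_ne_zero
  have h1 : q ^ (m + 1) = q ^ m * q := zpow_add_one₀ q_ne_zero m
  have h2 : q ^ (-(m + 1)) = q ^ (-m) * q⁻¹ := by
    rw [neg_add, zpow_add₀ q_ne_zero, zpow_neg_one]
  have h3 : q ^ (m - 2 + 1) = q ^ m * q⁻¹ := by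
    rw [show m - 2 + 1 = m + -1 by ring, zpow_add₀ q_ne_zero, zpow_neg_one]
  have h4 : q ^ (-(m - 2 + 1)) = q ^ (-m) * q := by
    rw [show -(m - 2 + 1) = -m + 1 by ring, zpow_add_one₀ q_ne_zero]
  rw [chi, chi, qz, h1, h2, h3, h4, ← sub_div, pow_two, ← div_div]
  congr 1
  rw [div_eq_iff hq]
  ring

/-! ### The Casimir element and weight strings. -/

/-- `U_q(sl₂)` is generated by `E`, `F` and the `K w`. -/
theorem Uq.induction {p : Uq → Prop} (halg : ∀ r : 𝕂, p (algebraMap 𝕂 Uq r)) (hE : p E) (hF : p F)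
    (hK : ∀ w, p (K w)) (hmul : ∀ x y, p x → p y → p (x * y))
    (hadd : ∀ x y, p x → p y → p (x + y)) (x : Uq) : p x := by
  obtain ⟨y, rfl⟩ := RingQuot.mkAlgHom_surjective 𝕂 Rel x
  change p (Uq.mk y)
  induction y using FreeAlgebra.induction with
  | grade0 r => rw [AlgHom.commutes]; exact halg r
  | grade1 x =>
    cases x with
    | E => exact hE
    | F => exact hF
    | K w => exact hK w
  | mul a b ha hb => rw [map_mul]; exact hmul _ _ ha hb
  | add a b ha hb => rw [map_add]; exact hadd _ _ ha hb

/-- The quantum Casimir element. -/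
def casimir : Uq := F * E + ((q - q⁻¹) ^ 2)⁻¹ • (q • K 2 + q⁻¹ • K (-2))

namespace Rep
variable {V : Rep} {m : ℤ} {v : V.V}

theorem K_two_apply (hv : v ∈ V.wt m) : V.ρ (K 2) v = q ^ m • v := by
  rw [hv 2, q_zpow]; congr 2

theorem K_neg_two_apply (hv : v ∈ V.wt m) : V.ρ (K (-2)) v = q ^ (-m) • v := by
  rw [hv (-2), q_zpow]; congr 2; ring

theorem casimir_apply (hv : v ∈ V.wt m) :
    V.ρ casimir v = V.ρ F (V.ρ E v) + chi m • v := by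
  rw [casimir, map_add, map_mul, map_smul, map_add, map_smul, map_smul, LinearMap.add_apply,
    Module.End.mul_apply, LinearMap.smul_apply, LinearMap.add_apply, LinearMap.smul_apply,
    LinearMap.smul_apply, K_two_apply hv, K_neg_two_apply hv, smul_smul, smul_smul, ← add_smul,
    smul_smul, chi]
  congr 2
  rw [neg_add, zpow_add_one₀ q_ne_zero, zpow_add₀ q_ne_zero, zpow_neg_one]
  ring

theorem E_F_apply (hv : v ∈ V.wt m) :
    V.ρ E (V.ρ F v) = V.ρ F (V.ρ E v) + qz m • v := by
  have h := congrArg (fun x => V.ρ x v) E_mul_F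
  simp only [map_sub, map_mul, map_smul, LinearMap.sub_apply, Module.End.mul_apply,
    LinearMap.smul_apply, K_two_apply hv, K_neg_two_apply hv] at h
  rw [← sub_smul, smul_smul] at h
  rw [← sub_eq_iff_eq_add', h, qz, div_eq_inv_mul]

theorem casimir_apply' (hv : v ∈ V.wt m) :
    V.ρ casimir v = V.ρ E (V.ρ F v) + chi (m - 2) • v := by
  rw [casimir_apply hv, E_F_apply hv, add_assoc, ← add_smul, ← chi_sub_chi]
  simp

theorem F_E_apply (hv : v ∈ V.wt m) :
    V.ρ F (V.ρ E v) = V.ρ casimir v - chi m • v := by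
  rw [casimir_apply hv, add_sub_cancel_right]

theorem E_F_apply' (hv : v ∈ V.wt m) :
    V.ρ E (V.ρ F v) = V.ρ casimir v - chi (m - 2) • v := by
  rw [casimir_apply' hv, add_sub_cancel_right]

/-- The expressions of the Casimir element through `F E` at weight `m` and through `E F` at weight
`m + 2` involve the same scalar `chi m`, which settles `E`; `F` is symmetric, and the `K w` commute
because weights are preserved. -/
theorem casimir_commute (x : Uq) : Commute (V.ρ casimir) (V.ρ x) := by
  induction x using Uq.induction with
  | halg r => rw [AlgHom.commutes]; exact (Algebra.commutes r _).symm
  | hE =>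
    refine ext_wt fun m v hv => ?_
    rw [Module.End.mul_apply, Module.End.mul_apply, casimir_apply' (E_mem hv), casimir_apply hv,
      map_add, map_smul, add_sub_cancel_right]
  | hF =>
    refine ext_wt fun m v hv => ?_
    rw [Module.End.mul_apply, Module.End.mul_apply, casimir_apply (F_mem hv), casimir_apply' hv,
      map_add, map_smul]
  | hK w =>
    have hw : ∀ m, ∀ v ∈ V.wt m, V.ρ casimir v ∈ V.wt m := by
      intro m v hv
      rw [casimir_apply hv]
      refine Submodule.add_mem _ ?_ (Submodule.smul_mem _ _ hv)
      simpa using F_mem (E_mem hv)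
    refine ext_wt fun m v hv => ?_
    rw [Module.End.mul_apply, Module.End.mul_apply, hv w, hw m v hv w, map_smul]
  | hmul x y hx hy => rw [map_mul]; exact hx.mul_right hy
  | hadd x y hx hy => rw [map_add]; exact hx.add_right hy

theorem casimir_apply_apply (x : Uq) (v : V.V) :
    V.ρ casimir (V.ρ x v) = V.ρ x (V.ρ casimir v) :=
  LinearMap.congr_fun (casimir_commute x).eq v

theorem casimir_apply_pow (x : Uq) (k : ℕ) (v : V.V) :
    V.ρ casimir ((V.ρ x ^ k) v) = (V.ρ x ^ k) (V.ρ casimir v) := by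
  rw [← map_pow, casimir_apply_apply]

theorem aeval_casimir_apply (p : Polynomial 𝕂) (x : Uq) (v : V.V) :
    Polynomial.aeval (V.ρ casimir) p (V.ρ x v) = V.ρ x (Polynomial.aeval (V.ρ casimir) p v) := by
  induction p using Polynomial.induction_on' with
  | add p r hp hr => simp only [map_add, LinearMap.add_apply, hp, hr]
  | monomial n c =>
    simp only [Polynomial.aeval_monomial, Module.End.mul_apply, Module.algebraMap_end_apply,
      map_smul]
    congr 1
    exact LinearMap.congr_fun ((casimir_commute x).pow_left n).eq v

theorem aeval_apply_of_eq_smul {M : Type} [AddCommGroup M] [Module 𝕂 M] {f : Module.End 𝕂 M}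
    {c : 𝕂} {v : M} (h : f v = c • v) (p : Polynomial 𝕂) :
    Polynomial.aeval f p v = p.eval c • v := by
  by_cases hv : v = 0
  · simp [hv]
  · exact Module.End.aeval_apply_of_hasEigenvector
      ⟨Module.End.mem_eigenspace_iff.2 h, hv⟩

theorem E_pow_mem (hv : v ∈ V.wt m) (k : ℕ) : (V.ρ E ^ k) v ∈ V.wt (m + 2 * k) := by
  induction k with
  | zero => simpa using hv
  | succ k ih =>
    rw [pow_succ', Module.End.mul_apply]
    have := E_mem ih
    convert this using 2
    push_cast; ring

theorem F_pow_mem (hv : v ∈ V.wt m) (k : ℕ) : (V.ρ F ^ k) v ∈ V.wt (m - 2 * k) := by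
  induction k with
  | zero => simpa using hv
  | succ k ih =>
    rw [pow_succ', Module.End.mul_apply]
    have := F_mem ih
    convert this using 2
    push_cast; ring

/-- The innermost `F E` acts on weight `m + 2k` as the Casimir element minus `chi (m + 2k)`, and
this factor commutes past the remaining powers. Nilpotency of `E` thereby becomes a polynomial
equation for the Casimir element. -/
theorem F_pow_E_pow (hv : v ∈ V.wt m) (k : ℕ) : (V.ρ F ^ k) ((V.ρ E ^ k) v) =
    Polynomial.aeval (V.ρ casimir)
      (∏ i ∈ Finset.range k, (Polynomial.X - Polynomial.C (chi (m + 2 * i)))) v := by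
  induction k with
  | zero => simp
  | succ k ih =>
    rw [pow_succ, pow_succ', Module.End.mul_apply, Module.End.mul_apply,
      F_E_apply (E_pow_mem hv k), Finset.prod_range_succ_comm, map_mul, Module.End.mul_apply,
      ← ih, ← map_pow, ← map_pow, aeval_casimir_apply, aeval_casimir_apply, map_sub, map_sub]
    simp only [map_smul, Polynomial.aeval_X, Polynomial.aeval_C, LinearMap.sub_apply,
      Module.algebraMap_end_apply]
    simp only [map_pow, map_sub, map_smul, casimir_apply_pow]

theorem E_pow_F_pow (hv : v ∈ V.wt m) (k : ℕ) : (V.ρ E ^ k) ((V.ρ F ^ k) v) =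
    Polynomial.aeval (V.ρ casimir)
      (∏ i ∈ Finset.range k, (Polynomial.X - Polynomial.C (chi (m - 2 * i - 2)))) v := by
  induction k with
  | zero => simp
  | succ k ih =>
    rw [pow_succ, pow_succ', Module.End.mul_apply, Module.End.mul_apply,
      E_F_apply' (F_pow_mem hv k), Finset.prod_range_succ_comm, map_mul, Module.End.mul_apply,
      ← ih, ← map_pow, ← map_pow, aeval_casimir_apply, aeval_casimir_apply, map_sub, map_sub]
    simp only [map_smul, Polynomial.aeval_X, Polynomial.aeval_C, LinearMap.sub_apply,
      Module.algebraMap_end_apply]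
    simp only [map_pow, map_sub, map_smul, casimir_apply_pow]

theorem F_pow_E_pow_of_casimir (hv : v ∈ V.wt m) {c : 𝕂} (hc : V.ρ casimir v = c • v) (k : ℕ) :
    (V.ρ F ^ k) ((V.ρ E ^ k) v) = (∏ i ∈ Finset.range k, (c - chi (m + 2 * i))) • v := by
  rw [F_pow_E_pow hv, aeval_apply_of_eq_smul hc, Polynomial.eval_prod]
  simp

theorem E_pow_F_pow_of_casimir (hv : v ∈ V.wt m) {c : 𝕂} (hc : V.ρ casimir v = c • v) (k : ℕ) :
    (V.ρ E ^ k) ((V.ρ F ^ k) v) = (∏ i ∈ Finset.range k, (c - chi (m - 2 * i - 2))) • v := by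
  rw [E_pow_F_pow hv, aeval_apply_of_eq_smul hc, Polynomial.eval_prod]
  simp

theorem casimir_pow_apply {x : Uq} {c : 𝕂} (hc : V.ρ casimir v = c • v) (k : ℕ) :
    V.ρ casimir ((V.ρ x ^ k) v) = c • (V.ρ x ^ k) v := by
  rw [← map_pow, casimir_apply_apply, hc, map_smul]

/-- The weights of the part of `V` on which the Casimir element acts by `chi n` lie in
`[-n, n]`. -/
theorem eq_zero_of_casimir (hv : v ∈ V.wt m) {n : ℕ} (hc : V.ρ casimir v = chi n • v)
    (hm : (n : ℤ) < |m|) : v = 0 := by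
  rcases lt_abs.1 hm with h | h
  -- At the exponent `dim V` the left side vanishes, while no factor `chi n - chi (m + 2i)` does
  -- once `m > n`; the other case uses `F` instead of `E`.
  · have h1 := F_pow_E_pow_of_casimir hv hc (Module.finrank 𝕂 V.V)
    rw [V.E_pow_eq_zero le_rfl, LinearMap.zero_apply, map_zero] at h1
    refine (smul_eq_zero.1 h1.symm).resolve_left (Finset.prod_ne_zero_iff.2 fun i _ => ?_)
    rw [sub_ne_zero, Ne, chi_eq_iff]
    omega
  · have h1 := E_pow_F_pow_of_casimir hv hc (Module.finrank 𝕂 V.V)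
    rw [V.F_pow_eq_zero le_rfl, LinearMap.zero_apply, map_zero] at h1
    refine (smul_eq_zero.1 h1.symm).resolve_left (Finset.prod_ne_zero_iff.2 fun i _ => ?_)
    rw [sub_ne_zero, Ne, chi_eq_iff]
    omega

/-- A polynomial with distinct roots kills `v`, so the Lagrange basis polynomials, which sum to 1,
split `v` into Casimir eigenvectors; polynomials in the Casimir element preserve the weight. -/
theorem mem_of_aeval_prod_eq_zero {S : Submodule 𝕂 V.V} (hv : v ∈ V.wt m) {k : ℕ} {x : ℕ → 𝕂}
    (hx : Set.InjOn x (Finset.range k))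
    (h0 : Polynomial.aeval (V.ρ casimir)
      (∏ i ∈ Finset.range k, (Polynomial.X - Polynomial.C (x i))) v = 0)
    (h : ∀ i, ∀ u ∈ V.wt m, V.ρ casimir u = x i • u → u ∈ S) : v ∈ S := by
  have hmem : ∀ p : Polynomial 𝕂, Polynomial.aeval (V.ρ casimir) p v ∈ V.wt m := by
    intro p w
    rw [← aeval_casimir_apply, hv w, map_smul]
  rcases Nat.eq_zero_or_pos k with rfl | hk
  · have : v = 0 := by simpa using h0
    rw [this]; exact S.zero_mem
  have h1 := congrArg (fun p => Polynomial.aeval (V.ρ casimir) p v)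
    (Lagrange.sum_basis hx (Finset.nonempty_range_iff.2 hk.ne'))
  simp only [map_sum, LinearMap.sum_apply, map_one, Module.End.one_apply] at h1
  rw [← h1]
  refine S.sum_mem fun i hi => h i _ (hmem _) ?_
  rw [← sub_eq_zero]
  have h2 : (Polynomial.X - Polynomial.C (x i)) * Lagrange.basis (Finset.range k) x i =
      Polynomial.C (∏ j ∈ (Finset.range k).erase i, (x i - x j)⁻¹) *
        ∏ i ∈ Finset.range k, (Polynomial.X - Polynomial.C (x i)) := by
    rw [Lagrange.basis, ← Finset.mul_prod_erase _ _ hi, map_prod, mul_left_comm,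
      ← Finset.prod_mul_distrib]
    rfl
  have h3 := congrArg (fun p => Polynomial.aeval (V.ρ casimir) p v) h2
  simp only [map_mul, Module.End.mul_apply, h0, map_zero] at h3
  simpa using h3

/-- A representation is spanned by weight vectors that are eigenvectors of the Casimir element. -/
theorem eq_top_of_casimir (S : Submodule 𝕂 V.V) (h : ∀ n k : ℕ, k ≤ n → ∀ v ∈ V.wt (n - 2 * k),
    V.ρ casimir v = chi n • v → v ∈ S) : S = ⊤ := by
  have h' : ∀ n k : ℕ, ∀ v ∈ V.wt (n - 2 * k), V.ρ casimir v = chi n • v → v ∈ S := by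
    intro n k v hv hc
    by_cases hk : k ≤ n
    · exact h n k hk v hv hc
    · rw [eq_zero_of_casimir hv hc (by rw [lt_abs]; omega)]
      exact S.zero_mem
  rw [eq_top_iff, ← V.type_one]
  refine iSup_le fun m v hv => ?_
  -- The roots `chi (m + 2i)` are distinct for `m ≥ 0` but may repeat for negative `m`, by the
  -- symmetry `m ↦ -m - 2`; there nilpotency of `F` supplies distinct roots.
  rcases le_or_gt 0 m with hm | hm
  · lift m to ℕ using hm
    refine mem_of_aeval_prod_eq_zero (k := Module.finrank 𝕂 V.V)
      (x := fun i => chi (m + 2 * i)) hv ?_ ?_ ?_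
    · intro i _ j _ hij
      have := chi_eq_iff.1 hij
      omega
    · rw [← F_pow_E_pow hv, V.E_pow_eq_zero le_rfl, LinearMap.zero_apply, map_zero]
    · intro i u hu hc
      refine h' (m + 2 * i) i u ?_ ?_
      · convert hu using 2; push_cast; ring
      · rw [hc]; push_cast; rfl
  · obtain ⟨l, rfl⟩ : ∃ l : ℕ, m = -l := ⟨m.natAbs, by omega⟩
    refine mem_of_aeval_prod_eq_zero (k := Module.finrank 𝕂 V.V)
      (x := fun i => chi (-l - 2 * i - 2)) hv ?_ ?_ ?_
    · intro i _ j _ hij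
      have := chi_eq_iff.1 hij
      omega
    · rw [← E_pow_F_pow hv, V.F_pow_eq_zero le_rfl, LinearMap.zero_apply, map_zero]
    · intro i u hu hc
      refine h' (l + 2 * i) (l + i) u ?_ ?_
      · convert hu using 2; push_cast; ring
      · rw [hc]
        congr 1
        rw [chi_eq_iff]
        push_cast; right; ring

/-- `w` is a highest weight vector of weight `n`, or zero. -/
structure IsHighest (V : Rep) (n : ℕ) (w : V.V) : Prop where
  mem : w ∈ V.wt n
  E_apply : V.ρ E w = 0

namespace IsHighest
variable {n : ℕ} {w : V.V}

theorem casimir_apply (hw : IsHighest V n w) : V.ρ casimir w = chi n • w := by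
  rw [Rep.casimir_apply hw.mem, hw.E_apply, map_zero, zero_add]

theorem F_pow_eq_zero (hw : IsHighest V n w) {k : ℕ} (hk : n < k) : (V.ρ F ^ k) w = 0 :=
  eq_zero_of_casimir (F_pow_mem hw.mem k) (casimir_pow_apply hw.casimir_apply k)
    (by rw [lt_abs]; omega)

theorem exists_E_pow (hw : IsHighest V n w) {k : ℕ} (hk : k ≤ n) :
    ∃ c : 𝕂, c ≠ 0 ∧ (V.ρ E ^ k) ((V.ρ F ^ k) w) = c • w := by
  refine ⟨_, Finset.prod_ne_zero_iff.2 fun i hi => ?_,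
    E_pow_F_pow_of_casimir hw.mem hw.casimir_apply k⟩
  rw [Finset.mem_range] at hi
  rw [sub_ne_zero, Ne, chi_eq_iff]
  omega

theorem F_pow_ne_zero (hw : IsHighest V n w) (h0 : w ≠ 0) {k : ℕ} (hk : k ≤ n) :
    (V.ρ F ^ k) w ≠ 0 := by
  intro h
  obtain ⟨c, hc, h1⟩ := hw.exists_E_pow hk
  rw [h, map_zero, eq_comm, smul_eq_zero] at h1
  tauto

end IsHighest

/-- A representation is spanned by the vectors `F ^ k w` with `w` a highest weight vector. -/
theorem eq_top_of_highest (S : Submodule 𝕂 V.V) (h : ∀ n k : ℕ, k ≤ n → ∀ w, IsHighest V n w →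
    (V.ρ F ^ k) w ∈ S) : S = ⊤ := by
  refine eq_top_of_casimir S fun n k hk v hv hc => ?_
  -- `E ^ k v` has weight `n`, the largest allowed by its Casimir eigenvalue, so it is a highest
  -- weight vector; applying `F ^ k` returns a nonzero multiple of `v`.
  have h1 := h n k hk ((V.ρ E ^ k) v) ⟨by simpa using E_pow_mem hv k, ?_⟩
  · rw [F_pow_E_pow_of_casimir hv hc] at h1
    refine (S.smul_mem_iff (Finset.prod_ne_zero_iff.2 fun i hi => ?_)).1 h1
    rw [Finset.mem_range] at hi
    rw [sub_ne_zero, Ne, chi_eq_iff]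
    omega
  · rw [← Module.End.mul_apply, ← pow_succ']
    refine eq_zero_of_casimir (E_pow_mem hv (k + 1)) (casimir_pow_apply hc _) ?_
    rw [lt_abs]; push_cast; omega

/-- A representation is spanned by the vectors `E ^ k u` with `u` a lowest weight vector. -/
theorem eq_top_of_lowest (S : Submodule 𝕂 V.V) (h : ∀ n k : ℕ, k ≤ n → ∀ u ∈ V.wt (-n),
    V.ρ F u = 0 → (V.ρ E ^ k) u ∈ S) : S = ⊤ := by
  refine eq_top_of_casimir S fun n k hk v hv hc => ?_
  have h1 := h n (n - k) (Nat.sub_le _ _) ((V.ρ F ^ (n - k)) v) ?_ ?_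
  · rw [E_pow_F_pow_of_casimir hv hc] at h1
    refine (S.smul_mem_iff (Finset.prod_ne_zero_iff.2 fun i hi => ?_)).1 h1
    rw [Finset.mem_range] at hi
    rw [sub_ne_zero, Ne, chi_eq_iff]
    omega
  · convert F_pow_mem hv (n - k) using 2
    push_cast [hk]; ring
  · rw [← Module.End.mul_apply, ← pow_succ']
    refine eq_zero_of_casimir (F_pow_mem hv _) (casimir_pow_apply hc _) ?_
    rw [lt_abs]; push_cast [hk]; omega

theorem E_pow_lowest_eq_zero {n : ℕ} {u : V.V} (hu : u ∈ V.wt (-n)) (hF : V.ρ F u = 0) {k : ℕ}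
    (hk : n < k) : (V.ρ E ^ k) u = 0 := by
  refine eq_zero_of_casimir (n := n) (E_pow_mem hu k) (casimir_pow_apply ?_ k)
    (by rw [lt_abs]; omega)
  rw [casimir_apply' hu, hF, map_zero, zero_add]
  congr 1
  rw [chi_eq_iff]
  omega

end Rep

/-! ### Highest weight vectors and the completion. -/

/-- An element acts on all highest weight vectors of a given weight by the same polynomial
in `F`. -/
theorem exists_aeval_F (n : ℕ) (x : Uq) : ∃ p : Polynomial 𝕂, ∀ (V : Rep) (w : V.V),
    V.IsHighest n w → V.ρ x w = V.ρ (Polynomial.aeval F p) w := by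
  -- Letting `x` act on an arbitrary polynomial in `F` applied to `w` makes the claim stable under
  -- products.
  suffices h : ∀ r : Polynomial 𝕂, ∃ p : Polynomial 𝕂, ∀ (V : Rep) (w : V.V),
      V.IsHighest n w → V.ρ x (V.ρ (Polynomial.aeval F r) w) = V.ρ (Polynomial.aeval F p) w by
    obtain ⟨p, hp⟩ := h 1
    exact ⟨p, fun V w hw => by simpa using hp V w hw⟩
  have hadd : ∀ (x : Uq) (r₁ r₂ : Polynomial 𝕂),
      (∃ p : Polynomial 𝕂, ∀ (V : Rep) (w : V.V), V.IsHighest n w →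
        V.ρ x (V.ρ (Polynomial.aeval F r₁) w) = V.ρ (Polynomial.aeval F p) w) →
      (∃ p : Polynomial 𝕂, ∀ (V : Rep) (w : V.V), V.IsHighest n w →
        V.ρ x (V.ρ (Polynomial.aeval F r₂) w) = V.ρ (Polynomial.aeval F p) w) →
      ∃ p : Polynomial 𝕂, ∀ (V : Rep) (w : V.V), V.IsHighest n w →
        V.ρ x (V.ρ (Polynomial.aeval F (r₁ + r₂)) w) = V.ρ (Polynomial.aeval F p) w := by
    rintro x r₁ r₂ ⟨p₁, h₁⟩ ⟨p₂, h₂⟩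
    exact ⟨p₁ + p₂, fun V w hw => by simp [h₁ V w hw, h₂ V w hw]⟩
  induction x using Uq.induction with
  | halg c => exact fun r => ⟨c • r, fun V w _ => by simp⟩
  | hF => exact fun r => ⟨Polynomial.X * r, fun V w _ => by simp⟩
  | hK l =>
    intro r
    induction r using Polynomial.induction_on' with
    | add r₁ r₂ h₁ h₂ => exact hadd _ _ _ h₁ h₂
    | monomial j c =>
      refine ⟨s ^ (2 * l * (n - 2 * j)) • Polynomial.monomial j c, fun V w hw => ?_⟩
      simp only [Polynomial.aeval_monomial, map_smul, map_mul, map_pow, AlgHom.commutes,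
        Module.End.mul_apply, Module.algebraMap_end_apply, LinearMap.smul_apply]
      rw [Rep.F_pow_mem hw.mem j l, smul_comm]
  | hE =>
    intro r
    induction r using Polynomial.induction_on' with
    | add r₁ r₂ h₁ h₂ => exact hadd _ _ _ h₁ h₂
    | monomial j c =>
      cases j with
      | zero =>
        refine ⟨0, fun V w hw => ?_⟩
        simp [hw.E_apply]
      | succ j =>
        refine ⟨(chi n - chi (n - 2 * j - 2)) • Polynomial.monomial j c, fun V w hw => ?_⟩
        simp only [Polynomial.aeval_monomial, map_smul, map_mul, map_pow, AlgHom.commutes,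
          Module.End.mul_apply, Module.algebraMap_end_apply, LinearMap.smul_apply, pow_succ' _ j]
        rw [Rep.E_F_apply' (Rep.F_pow_mem hw.mem j), Rep.casimir_pow_apply hw.casimir_apply,
          ← sub_smul, smul_comm]
  | hmul x y hx hy =>
    intro r
    obtain ⟨p, hp⟩ := hy r
    obtain ⟨p', hp'⟩ := hx p
    exact ⟨p', fun V w hw => by rw [map_mul, Module.End.mul_apply, hp V w hw, hp' V w hw]⟩
  | hadd x y hx hy =>
    intro r
    obtain ⟨p, hp⟩ := hx r
    obtain ⟨p', hp'⟩ := hy r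
    exact ⟨p + p', fun V w hw => by simp [hp V w hw, hp' V w hw]⟩

namespace Rep

/-- An element of `U_q(sl₂)` that picks out the coefficients of the powers of `F` applied to a
highest weight vector. -/
theorem exists_coeff_apply (V : Rep) (n k : ℕ) : ∃ y : Uq, ∀ w, V.IsHighest n w →
    ∀ p : Polynomial 𝕂, V.ρ y (V.ρ (Polynomial.aeval F p) w) = p.coeff k • (V.ρ F ^ k) w := by
  classical
  obtain ⟨y, hy⟩ := exists_interp {V} (Pi.single ((n : ℤ) - 2 * k) 1)
  refine ⟨y, fun w hw p => ?_⟩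
  induction p using Polynomial.induction_on' with
  | add p r hp hr => simp only [map_add, LinearMap.add_apply, hp, hr, Polynomial.coeff_add, add_smul]
  | monomial j c =>
    simp only [Polynomial.aeval_monomial, map_mul, map_pow, AlgHom.commutes,
      Module.End.mul_apply, Module.algebraMap_end_apply, map_smul]
    rw [hy V (Finset.mem_singleton_self V) _ _ (F_pow_mem hw.mem j), Polynomial.coeff_monomial]
    by_cases h : j = k
    · subst h; simp
    · rw [if_neg h, Pi.single_eq_of_ne (by omega)]; simp

theorem IsHighest.coeff_eq_zero {V : Rep} {n : ℕ} {w : V.V} (hw : V.IsHighest n w) (h0 : w ≠ 0)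
    {p : Polynomial 𝕂} (hp : V.ρ (Polynomial.aeval F p) w = 0) {k : ℕ} (hk : k ≤ n) :
    p.coeff k = 0 := by
  obtain ⟨y, hy⟩ := V.exists_coeff_apply n k
  have := hy w hw p
  rw [hp, map_zero, eq_comm, smul_eq_zero] at this
  exact this.resolve_right (hw.F_pow_ne_zero h0 hk)

theorem IsHighest.aeval_F_apply {V : Rep} {n : ℕ} {w : V.V} (hw : V.IsHighest n w)
    (p : Polynomial 𝕂) : V.ρ (Polynomial.aeval F p) w =
      ∑ k ∈ Finset.range (n + 1), p.coeff k • (V.ρ F ^ k) w := by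
  induction p using Polynomial.induction_on' with
  | add p r hp hr =>
    simp only [map_add, LinearMap.add_apply, hp, hr, Polynomial.coeff_add, add_smul,
      Finset.sum_add_distrib]
  | monomial j c =>
    simp only [Polynomial.aeval_monomial, map_mul, map_pow, AlgHom.commutes,
      Module.End.mul_apply, Module.algebraMap_end_apply, Polynomial.coeff_monomial, ite_smul,
      zero_smul, Finset.sum_ite_eq, Finset.mem_range]
    split_ifs with h
    · rfl
    · rw [hw.F_pow_eq_zero (by omega), smul_zero]

/-- An element that kills a nonzero highest weight vector kills all highest weight vectors of the
same weight. -/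
theorem apply_highest_eq_zero {V W : Rep} {n : ℕ} {v : V.V} {w : W.V} (hv : V.IsHighest n v)
    (h0 : v ≠ 0) (hw : W.IsHighest n w) {x : Uq} (hx : V.ρ x v = 0) : W.ρ x w = 0 := by
  obtain ⟨p, hp⟩ := exists_aeval_F n x
  rw [hp V v hv] at hx
  rw [hp W w hw, hw.aeval_F_apply]
  refine Finset.sum_eq_zero fun k hk => ?_
  rw [hv.coeff_eq_zero h0 hx (by rw [Finset.mem_range] at hk; omega), zero_smul]

end Rep

theorem completion_exists (a : completion) (V W : Rep) :
    ∃ x : Uq, a.1 V = V.ρ x ∧ a.1 W = W.ρ x := by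
  classical
  obtain ⟨x, hx⟩ := a.2 {V, W}
  exact ⟨x, hx V (by simp), hx W (by simp)⟩

/-- On `V` and `W` simultaneously `a` agrees with one `x` in `U_q(sl₂)`; if `x - c` kills `v` it
kills `w`. -/
theorem completion_apply_highest (a : completion) {V W : Rep} {n : ℕ} {v : V.V} {w : W.V}
    (hv : V.IsHighest n v) (h0 : v ≠ 0) (hw : W.IsHighest n w) {c : 𝕂} (h : a.1 V v = c • v) :
    a.1 W w = c • w := by
  obtain ⟨x, hV, hW⟩ := completion_exists a V W
  have := Rep.apply_highest_eq_zero hv h0 hw (x := x - algebraMap 𝕂 Uq c) (by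
    rw [map_sub, AlgHom.commutes, LinearMap.sub_apply, ← hV, h, Module.algebraMap_end_apply,
      sub_self])
  rwa [map_sub, AlgHom.commutes, LinearMap.sub_apply, ← hW, Module.algebraMap_end_apply,
    sub_eq_zero] at this

/-- Elements of the completion are determined by their action on a family of representations that
contains nonzero highest weight vectors of all weights. -/
theorem completion_ext {a b : completion} (P : ℕ → Rep) (w : ∀ n, (P n).V)
    (hw : ∀ n, (P n).IsHighest n (w n)) (h0 : ∀ n, w n ≠ 0) (h : ∀ n, a.1 (P n) = b.1 (P n)) :
    a = b := by
  refine Subtype.ext (funext fun V => ?_)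
  have : LinearMap.eqLocus (a.1 V) (b.1 V) = ⊤ := by
    refine Rep.eq_top_of_highest _ fun n k _ v hv => ?_
    obtain ⟨x, hV, hP⟩ := completion_exists a V (P n)
    obtain ⟨y, hV', hP'⟩ := completion_exists b V (P n)
    rw [LinearMap.mem_eqLocus, hV, hV', ← sub_eq_zero, ← LinearMap.sub_apply, ← map_sub,
      ← map_pow, ← Module.End.mul_apply, ← map_mul]
    refine Rep.apply_highest_eq_zero (hw n) (h0 n) hv ?_
    rw [map_mul, Module.End.mul_apply, map_sub, ← hP, ← hP', h, sub_self, LinearMap.zero_apply]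
  refine LinearMap.ext fun v => ?_
  have hv : v ∈ LinearMap.eqLocus (a.1 V) (b.1 V) := by rw [this]; trivial
  exact hv

/-- An element of the completion that acts injectively on every representation is invertible. -/
theorem isUnit_of_injective (a : completion) (ha : ∀ V : Rep, Function.Injective (a.1 V)) :
    IsUnit a := by
  classical
  have hu : ∀ V : Rep, ∃ f : Module.End 𝕂 V.V, f * a.1 V = 1 ∧ a.1 V * f = 1 := by
    intro V
    let e := LinearEquiv.ofInjectiveEndo (a.1 V) (ha V)
    exact ⟨e.symm.toLinearMap, LinearMap.ext fun v => e.symm_apply_apply v,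
      LinearMap.ext fun v => e.apply_symm_apply v⟩
  choose b hb hb' using hu
  have hmem : b ∈ completion := by
    intro S
    obtain ⟨x, hx⟩ := a.2 S
    let A := ∀ V : S, Module.End 𝕂 V.1.V
    let φ : Uq →ₐ[𝕂] A := AlgHom.pi fun V => V.1.ρ
    -- The pointwise inverse must again come from `U_q(sl₂)`. Left multiplication by `φ x` is
    -- injective on the finite-dimensional image `M`, hence surjective, so 1 is of the form `φ x * φ
    -- y`.
    let M : Submodule 𝕂 A := LinearMap.range φ.toLinearMap
    let f : Module.End 𝕂 M := (LinearMap.mulLeft 𝕂 (φ x)).restrict (by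
      rintro _ ⟨y, rfl⟩
      exact ⟨x * y, map_mul φ x y⟩)
    have hf : Function.Injective f := by
      intro y z hyz
      have h1 : φ x * y.1 = φ x * z.1 := congrArg Subtype.val hyz
      refine Subtype.ext (funext fun V => ?_)
      have h2 := congrFun h1 V
      have h3 : φ x V = a.1 V.1 := (hx V.1 V.2).symm
      rw [Pi.mul_apply, Pi.mul_apply, h3] at h2
      rw [← one_mul (y.1 V), ← hb V.1, mul_assoc, h2, ← mul_assoc, hb, one_mul]
    have hf' := (LinearMap.injective_iff_surjective.1 hf)
    obtain ⟨⟨_, y, rfl⟩, hy⟩ := hf' ⟨1, 1, map_one φ⟩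
    have hy' : φ x * φ y = 1 := congrArg Subtype.val hy
    refine ⟨y, fun V hV => ?_⟩
    have h2 : V.ρ x * V.ρ y = 1 := congrFun hy' ⟨V, hV⟩
    rw [← hx V hV] at h2
    rw [← mul_one (b V), ← h2, ← mul_assoc, hb, one_mul]
  refine ⟨⟨a, ⟨b, hmem⟩, Subtype.ext (funext hb'), Subtype.ext (funext hb)⟩, rfl⟩

/-! ### Cyclic highest weight modules and tensor powers of the standard representation. -/

namespace Rep
variable {V : Rep} {n : ℕ} {w : V.V}

/-- The action on an invariant subspace. -/
def restrict (N : Submodule 𝕂 V.V) (hN : ∀ x : Uq, ∀ v ∈ N, V.ρ x v ∈ N) :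
    Uq →ₐ[𝕂] Module.End 𝕂 N where
  toFun x := (V.ρ x).restrict (hN x)
  map_one' := LinearMap.ext fun v => Subtype.ext (by simp)
  map_mul' x y := LinearMap.ext fun v => Subtype.ext (by simp)
  map_zero' := LinearMap.ext fun v => Subtype.ext (by simp)
  map_add' x y := LinearMap.ext fun v => Subtype.ext (by simp)
  commutes' c := LinearMap.ext fun v => Subtype.ext (by simp)

/-- The subspace generated by a vector under the action. -/
def orbit (w : V.V) : Submodule 𝕂 V.V := LinearMap.range ((LinearMap.applyₗ w).comp V.ρ.toLinearMap)

theorem mem_orbit {w v : V.V} : v ∈ orbit w ↔ ∃ x : Uq, V.ρ x w = v := Iff.rfl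

theorem orbit_invariant (w : V.V) (x : Uq) (v : V.V) (hv : v ∈ orbit w) :
    V.ρ x v ∈ orbit w := by
  obtain ⟨y, rfl⟩ := mem_orbit.1 hv
  exact mem_orbit.2 ⟨x * y, by simp⟩

/-- The subrepresentation generated by a highest weight vector. -/
def IsHighest.cyclic (hw : V.IsHighest n w) : Rep where
  V := orbit w
  ρ := restrict (orbit w) (orbit_invariant w)
  type_one := by
    rw [eq_top_iff]
    rintro ⟨v, hv⟩ -
    obtain ⟨x, hx⟩ := mem_orbit.1 hv
    obtain ⟨p, hp⟩ := exists_aeval_F n x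
    have h1 : v = ∑ k ∈ Finset.range (n + 1), p.coeff k • (V.ρ F ^ k) w := by
      rw [← hx, hp V w hw, hw.aeval_F_apply]
    have h2 : ∀ k : ℕ, (V.ρ F ^ k) w ∈ orbit w := fun k => mem_orbit.2 ⟨F ^ k, by rw [map_pow]⟩
    have h3 : (⟨v, hv⟩ : orbit w) =
        ∑ k ∈ Finset.range (n + 1), p.coeff k • (⟨(V.ρ F ^ k) w, h2 k⟩ : orbit w) := by
      refine Subtype.ext ?_
      rw [AddSubmonoidClass.coe_finsetSum]
      exact h1
    rw [h3]
    refine Submodule.sum_mem _ fun k _ => Submodule.smul_mem _ _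
      (Submodule.mem_iSup_of_mem ((n : ℤ) - 2 * k) ?_)
    intro l
    exact Subtype.ext (F_pow_mem hw.mem k l)

/-- The generator of the subrepresentation generated by a highest weight vector. -/
def IsHighest.gen (hw : V.IsHighest n w) : hw.cyclic.V :=
  (⟨w, mem_orbit.2 ⟨1, by simp⟩⟩ : orbit w)

/-- The inclusion of the subrepresentation generated by a highest weight vector. -/
def IsHighest.incl (hw : V.IsHighest n w) : hw.cyclic.V →ₗ[𝕂] V.V := (orbit w).subtype

theorem IsHighest.incl_gen (hw : V.IsHighest n w) : hw.incl hw.gen = w := rfl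

theorem IsHighest.incl_injective (hw : V.IsHighest n w) : Function.Injective hw.incl :=
  Subtype.val_injective

theorem IsHighest.incl_ρ (hw : V.IsHighest n w) (x : Uq) (v : hw.cyclic.V) :
    hw.incl (hw.cyclic.ρ x v) = V.ρ x (hw.incl v) := rfl

theorem IsHighest.isHighest_gen (hw : V.IsHighest n w) : hw.cyclic.IsHighest n hw.gen where
  mem l := hw.incl_injective (by rw [hw.incl_ρ, map_smul, incl_gen, hw.mem l])
  E_apply := hw.incl_injective (by rw [hw.incl_ρ, incl_gen, hw.E_apply, map_zero])

theorem IsHighest.gen_ne_zero (hw : V.IsHighest n w) (h0 : w ≠ 0) : hw.gen ≠ 0 := fun h =>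
  h0 (congrArg hw.incl h)

theorem IsHighest.exists_ρ_gen (hw : V.IsHighest n w) (v : hw.cyclic.V) :
    ∃ x : Uq, v = hw.cyclic.ρ x hw.gen := by
  obtain ⟨x, hx⟩ := mem_orbit.1 (v : orbit w).2
  exact ⟨x, hw.incl_injective (by rw [hw.incl_ρ, hw.incl_gen, hx]; rfl)⟩

/-- Every nonzero vector is a polynomial in `F` applied to the generator. A nonzero coefficient can
be isolated by its weight, and a power of `E` then raises that term back to the generator. -/
theorem IsHighest.isIrreducible_cyclic (hw : V.IsHighest n w) (h0 : w ≠ 0) :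
    IsIrreducibleOfHighestWeight hw.cyclic n where
  highest := ⟨hw.gen, hw.isHighest_gen.mem, hw.gen_ne_zero h0, hw.isHighest_gen.E_apply⟩
  irreducible := by
    intro W hW
    rw [or_iff_not_imp_left]
    intro hne
    obtain ⟨v, hv, hv0⟩ := (Submodule.ne_bot_iff _).1 hne
    obtain ⟨x, rfl⟩ := hw.exists_ρ_gen v
    have hg := hw.isHighest_gen
    obtain ⟨p, hp⟩ := exists_aeval_F n x
    rw [hp _ _ hg] at hv hv0
    obtain ⟨k, hk, hpk⟩ : ∃ k ∈ Finset.range (n + 1), p.coeff k ≠ 0 := by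
      by_contra! h
      apply hv0
      rw [hg.aeval_F_apply]
      exact Finset.sum_eq_zero fun k hk => by rw [h k hk, zero_smul]
    obtain ⟨y, hy⟩ := hw.cyclic.exists_coeff_apply n k
    obtain ⟨c, hc, hc'⟩ := hg.exists_E_pow (k := k) (by rw [Finset.mem_range] at hk; omega)
    have h1 : hw.gen ∈ W := by
      have h2 := hW (E ^ k) _ (hW y _ hv)
      rw [hy _ hg, map_smul, map_pow, hc'] at h2
      exact (W.smul_mem_iff hc).1 ((W.smul_mem_iff hpk).1 h2)
    rw [eq_top_iff]
    intro u _
    obtain ⟨z, rfl⟩ := hw.exists_ρ_gen u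
    exact hW z _ h1

/-- The tensor powers of the standard representation. -/
def stdPow : ℕ → Rep
  | 0 => triv
  | n + 1 => (stdPow n).tensor std

/-- The highest weight vector of the standard representation. -/
abbrev vPlus : std.V := Pi.single 0 1

/-- The lowest weight vector of the standard representation. -/
abbrev vMinus : std.V := Pi.single 1 1

theorem std_E_vPlus : std.ρ E vPlus = 0 := by
  rw [AlgHom.comp_apply, lift_E]
  change _ = (0 : Fin 2 → 𝕂)
  ext i
  fin_cases i <;> simp [Matrix.toLinAlgEquiv'_apply]

theorem std_E_vMinus : std.ρ E vMinus = vPlus := by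
  rw [AlgHom.comp_apply, lift_E]
  ext i
  fin_cases i <;> simp [Matrix.toLinAlgEquiv'_apply]

theorem std_F_vPlus : std.ρ F vPlus = vMinus := by
  rw [AlgHom.comp_apply, lift_F]
  ext i
  fin_cases i <;> simp [Matrix.toLinAlgEquiv'_apply]

theorem std_F_vMinus : std.ρ F vMinus = 0 := by
  rw [AlgHom.comp_apply, lift_F]
  change _ = (0 : Fin 2 → 𝕂)
  ext i
  fin_cases i <;> simp [Matrix.toLinAlgEquiv'_apply]

theorem vPlus_mem : vPlus ∈ std.wt 1 := by
  intro w
  rw [AlgHom.comp_apply, lift_K]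
  ext i
  fin_cases i <;> simp [Matrix.toLinAlgEquiv'_apply]

theorem vMinus_mem : vMinus ∈ std.wt (-1) := by
  intro w
  rw [AlgHom.comp_apply, lift_K]
  ext i
  fin_cases i <;> simp [Matrix.toLinAlgEquiv'_apply]

theorem isHighest_vPlus : std.IsHighest 1 vPlus := ⟨vPlus_mem, std_E_vPlus⟩

theorem vPlus_ne_zero : vPlus ≠ 0 := by simp

theorem isHighest_triv : triv.IsHighest 0 (1 : 𝕂) where
  mem w := by simp [counit]
  E_apply := by
    rw [AlgHom.comp_apply, counit, lift_E]
    simp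

theorem tensor_E_apply (V W : Rep) (v : V.V) (w : W.V) : (V.tensor W).ρ E (v ⊗ₜ w) =
    V.ρ E v ⊗ₜ W.ρ (K 2) w + v ⊗ₜ W.ρ E w := by
  rw [AlgHom.comp_apply, comul, lift_E, map_add, act₂_tmul, act₂_tmul]
  simp

theorem tensor_mem_wt {V W : Rep} {m n : ℤ} {v : V.V} {w : W.V} (hv : v ∈ V.wt m)
    (hw : w ∈ W.wt n) : v ⊗ₜ w ∈ (V.tensor W).wt (m + n) := by
  intro l
  rw [AlgHom.comp_apply, comul_K, act₂_tmul, TensorProduct.map_tmul, hv l, hw l,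
    TensorProduct.smul_tmul_smul, ← zpow_add₀ s_ne_zero]
  congr 2; ring

theorem IsHighest.tensor {V W : Rep} {m n : ℕ} {v : V.V} {w : W.V} (hv : V.IsHighest m v)
    (hw : W.IsHighest n w) : (V.tensor W).IsHighest (m + n) (v ⊗ₜ w) where
  mem := by
    have := tensor_mem_wt hv.mem hw.mem
    exact_mod_cast this
  E_apply := by rw [tensor_E_apply, hv.E_apply, hw.E_apply]; simp

theorem std_decomp (u : std.V) : u = u 0 • vPlus + u 1 • vMinus := by
  ext i
  fin_cases i <;> simp

theorem isIrreducible_std : IsIrreducibleOfHighestWeight std 1 where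
  highest := ⟨vPlus, vPlus_mem, vPlus_ne_zero, std_E_vPlus⟩
  irreducible := by
    intro W hW
    rw [or_iff_not_imp_left]
    intro hne
    obtain ⟨v, hv, hv0⟩ := (Submodule.ne_bot_iff _).1 hne
    have h1 : vPlus ∈ W := by
      by_cases h : v 1 = 0
      · rw [std_decomp v, h, zero_smul, add_zero] at hv
        refine (W.smul_mem_iff (s := v 0) (x := vPlus) fun h' => hv0 ?_).1 hv
        rw [std_decomp v, h, h']
        simp
      · have := hW E v hv
        rw [std_decomp v, map_add, map_smul, map_smul, std_E_vPlus, std_E_vMinus, smul_zero,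
          zero_add] at this
        exact (W.smul_mem_iff h).1 this
    have h2 : vMinus ∈ W := by rw [← std_F_vPlus]; exact hW F _ h1
    rw [eq_top_iff]
    intro u _
    rw [std_decomp u]
    exact W.add_mem (W.smul_mem _ h1) (W.smul_mem _ h2)

/-- The highest weight vector of a tensor power of the standard representation. -/
def stdPowHighest : ∀ n, (stdPow n).V
  | 0 => (1 : 𝕂)
  | n + 1 => (stdPowHighest n ⊗ₜ[𝕂] vPlus : (stdPow n).V ⊗[𝕂] std.V)

theorem isHighest_stdPowHighest : ∀ n, (stdPow n).IsHighest n (stdPowHighest n)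
  | 0 => isHighest_triv
  | n + 1 => (isHighest_stdPowHighest n).tensor isHighest_vPlus

theorem stdPowHighest_ne_zero : ∀ n, stdPowHighest n ≠ 0
  | 0 => one_ne_zero (α := 𝕂)
  | n + 1 => fun h => by
    have h1 : (stdPowHighest n ⊗ₜ[𝕂] vPlus : (stdPow n).V ⊗[𝕂] std.V) = 0 := h
    have h2 := congrArg (TensorProduct.rid 𝕂 _ ∘ TensorProduct.map LinearMap.id
      (LinearMap.proj 0 : (Fin 2 → 𝕂) →ₗ[𝕂] 𝕂)) h1
    simp only [Function.comp_apply, TensorProduct.map_tmul, map_zero, TensorProduct.rid_tmul] at h2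
    simp at h2
    exact stdPowHighest_ne_zero n h2

end Rep

/-! ### Existence and uniqueness of the standard ribbon element. -/

/-- The scalar by which the standard ribbon element acts on the irreducible representation of
highest weight `n`. -/
def ribbonScalar (n : ℕ) : 𝕂 := s ^ (-(2 * (n : ℤ) ^ 2 + 4 * n))

theorem chi_natCast_injective : Function.Injective (fun n : ℕ => chi n) := by
  intro a b h
  have := chi_eq_iff.1 h
  omega

theorem IsIrreducibleOfHighestWeight.casimir {V : Rep} {n : ℕ}
    (hV : IsIrreducibleOfHighestWeight V n) (v : V.V) : V.ρ QSl2.casimir v = chi n • v := by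
  obtain ⟨w, hw, h0, hE⟩ := hV.highest
  have h := hV.irreducible (LinearMap.ker (V.ρ QSl2.casimir - algebraMap 𝕂 _ (chi n))) (by
    intro x v hv
    rw [LinearMap.mem_ker, LinearMap.sub_apply, Module.algebraMap_end_apply, sub_eq_zero] at hv ⊢
    rw [Rep.casimir_apply_apply, hv, map_smul])
  have hw' : w ∈ LinearMap.ker (V.ρ QSl2.casimir - algebraMap 𝕂 _ (chi n)) := by
    rw [LinearMap.mem_ker, LinearMap.sub_apply, Module.algebraMap_end_apply, sub_eq_zero]
    exact Rep.IsHighest.casimir_apply ⟨hw, hE⟩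
  rcases h with h | h
  · rw [h] at hw'
    exact absurd hw' h0
  · have hv : v ∈ LinearMap.ker (V.ρ QSl2.casimir - algebraMap 𝕂 _ (chi n)) := by rw [h]; trivial
    rwa [LinearMap.mem_ker, LinearMap.sub_apply, Module.algebraMap_end_apply, sub_eq_zero] at hv

/-- On finitely many representations, any function of the highest weight is realized by a
polynomial in the Casimir element. -/
theorem exists_casimir_interp (S : Finset Rep) (f : ℕ → 𝕂) :
    ∃ x : Uq, ∀ V ∈ S, ∀ (n : ℕ) (v : V.V), V.ρ casimir v = chi n • v → V.ρ x v = f n • v := by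
  classical
  have hfin : (⋃ V ∈ S, {n : ℕ | ∃ v : V.V, v ≠ 0 ∧ V.ρ casimir v = chi n • v}).Finite := by
    refine S.finite_toSet.biUnion fun V _ => ?_
    have h1 : {n : ℕ | Module.End.eigenspace (V.ρ casimir) (chi n) ≠ ⊥}.Finite :=
      WellFoundedGT.finite_ne_bot_of_iSupIndep
        ((Module.End.eigenspaces_iSupIndep (V.ρ casimir)).comp chi_natCast_injective)
    refine h1.subset ?_
    rintro n ⟨v, hv, h⟩ h2
    have h3 := Module.End.mem_eigenspace_iff.2 h
    rw [h2] at h3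
    exact hv h3
  let p := Lagrange.interpolate hfin.toFinset (fun n : ℕ => chi n) f
  refine ⟨Polynomial.aeval casimir p, fun V hV n v hv => ?_⟩
  by_cases hv0 : v = 0
  · simp [hv0]
  have hn : n ∈ hfin.toFinset := by
    rw [Set.Finite.mem_toFinset, Set.mem_iUnion₂]
    exact ⟨V, hV, v, hv0, hv⟩
  rw [← Polynomial.aeval_algHom_apply, Rep.aeval_apply_of_eq_smul hv,
    Lagrange.eval_interpolate_at_node _ chi_natCast_injective.injOn hn]

/-- The Casimir eigenvalue determines the highest weight, so the scalars are interpolated by a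
polynomial in the Casimir element on any finite set of representations. Different interpolations
agree because Casimir eigenvectors span. -/
theorem exists_standardRibbonElement : ∃ C : completion, IsStandardRibbonElement C := by
  choose x hx using fun V : Rep => exists_casimir_interp {V} ribbonScalar
  refine ⟨⟨fun V => V.ρ (x V), fun S => ?_⟩, fun n V hV => ?_⟩
  · obtain ⟨y, hy⟩ := exists_casimir_interp S ribbonScalar
    refine ⟨y, fun V hV => ?_⟩
    have : LinearMap.eqLocus (V.ρ (x V)) (V.ρ y) = ⊤ :=
      Rep.eq_top_of_casimir _ fun n k _ v _ hv => by
        rw [LinearMap.mem_eqLocus, hy V hV n v hv, hx V V (Finset.mem_singleton_self V) n v hv]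
    refine LinearMap.ext fun v => ?_
    have hv : v ∈ LinearMap.eqLocus (V.ρ (x V)) (V.ρ y) := by rw [this]; trivial
    exact hv
  · exact LinearMap.ext fun v => hx V V (Finset.mem_singleton_self V) n v (hV.casimir v)

/-- The highest weight vector of the `n`-th tensor power of `V₁` generates an irreducible module of
highest weight `n`, where both elements are prescribed; such modules suffice to separate elements.
-/
theorem IsStandardRibbonElement.eq {c c' : completion} (hc : IsStandardRibbonElement c)
    (hc' : IsStandardRibbonElement c') : c = c' := by
  have hw := Rep.isHighest_stdPowHighest
  have h0 := Rep.stdPowHighest_ne_zero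
  refine completion_ext (fun n => (hw n).cyclic) (fun n => (hw n).gen)
    (fun n => (hw n).isHighest_gen) (fun n => (hw n).gen_ne_zero (h0 n)) fun n => ?_
  have hV := (hw n).isIrreducible_cyclic (h0 n)
  rw [hc n _ hV, hc' n _ hV]

theorem IsStandardRibbonElement.std {c : completion} (hc : IsStandardRibbonElement c) :
    c.1 Rep.std = s ^ (-6 : ℤ) • 1 := by
  rw [hc 1 _ Rep.isIrreducible_std]
  norm_num


/-! ### Divided powers with integer exponents. -/

/-- This is the scalar identity behind the induction step that commutes a divided power of `E` past
`F`. -/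
theorem qz_add_mul (m a : ℤ) : qz (m + 2 * a) + qz (m + a - 1) * qz a = qz (a + 1) * qz (m + a) := by
  have hq := q_sub_ne_zero
  have h0 := q_ne_zero
  have hA := zpow_ne_zero a q_ne_zero
  have hM := zpow_ne_zero m q_ne_zero
  simp only [qz]
  rw [div_mul_div_comm, div_mul_div_comm, div_add_div _ _ hq (mul_ne_zero hq hq),
    div_eq_div_iff (mul_ne_zero hq (mul_ne_zero hq hq)) (mul_ne_zero hq hq)]
  simp only [neg_add, two_mul, sub_eq_add_neg, neg_neg, zpow_add₀ q_ne_zero, zpow_neg,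
    zpow_one]
  field_simp
  ring

theorem qz_neg (m : ℤ) : qz (-m) = -qz m := by
  rw [qz, qz, neg_neg, ← neg_div, neg_sub]

theorem qFactorial_succ (n : ℕ) : qFactorial (n + 1) = qFactorial n * qz (n + 1) := by
  rw [qFactorial, Finset.prod_range_succ, ← qz_natCast]
  push_cast
  rfl

theorem qFactorial_ne_zero (n : ℕ) : qFactorial n ≠ 0 :=
  Finset.prod_ne_zero_iff.2 fun k _ => by
    rw [← qz_natCast]; exact qz_ne_zero (by omega)

section dp
variable {M : Type} [AddCommGroup M] [Module 𝕂 M]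

/-- The divided powers of an endomorphism, extended by zero to negative exponents. -/
def dp (f : Module.End 𝕂 M) (a : ℤ) : Module.End 𝕂 M :=
  if 0 ≤ a then (qFactorial a.toNat)⁻¹ • f ^ a.toNat else 0

theorem dp_natCast (f : Module.End 𝕂 M) (n : ℕ) : dp f n = (qFactorial n)⁻¹ • f ^ n := by
  simp [dp]

theorem dp_of_neg (f : Module.End 𝕂 M) {a : ℤ} (ha : a < 0) : dp f a = 0 := if_neg (by omega)

theorem dp_zero (f : Module.End 𝕂 M) : dp f 0 = 1 := by
  simp [dp, qFactorial]

theorem mul_dp (f : Module.End 𝕂 M) (a : ℤ) : f * dp f a = qz (a + 1) • dp f (a + 1) := by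
  rcases lt_trichotomy a (-1) with h | rfl | h
  · rw [dp_of_neg f (by omega), dp_of_neg f (by omega), mul_zero, smul_zero]
  · rw [dp_of_neg f (by omega)]; simp
  · lift a to ℕ using by omega
    rw [dp_natCast, show (a : ℤ) + 1 = ((a + 1 : ℕ) : ℤ) by push_cast; rfl, dp_natCast,
      qFactorial_succ, smul_smul, mul_smul_comm, ← pow_succ', mul_inv]
    congr 1
    push_cast
    rw [mul_left_comm, mul_inv_cancel₀ (qz_ne_zero (by omega)), mul_one]

theorem dp_mul (f : Module.End 𝕂 M) (a : ℤ) : dp f a * f = qz (a + 1) • dp f (a + 1) := by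
  rw [← mul_dp, dp]
  split_ifs
  · rw [smul_mul_assoc, mul_smul_comm, ← pow_succ, ← pow_succ']
  · simp

theorem apply_dp (f : Module.End 𝕂 M) (a : ℤ) (v : M) :
    f (dp f a v) = qz (a + 1) • dp f (a + 1) v := LinearMap.congr_fun (mul_dp f a) v

theorem dp_apply (f : Module.End 𝕂 M) (a : ℤ) (v : M) :
    dp f a (f v) = qz (a + 1) • dp f (a + 1) v := LinearMap.congr_fun (dp_mul f a) v

/-- Summing over all integers, with divided powers of negative exponent equal to zero, lets the
index shift without boundary terms. -/
theorem finsum_smul_shift {G : ℤ → M} (hG : G.support.Finite) (x y : ℤ → 𝕂) :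
    ∑ᶠ a, (x a • G (a + 1) + y a • G a) = ∑ᶠ a, (x (a - 1) + y a) • G a := by
  have hx : (Function.support fun a => x (a - 1) • G a).Finite :=
    hG.subset (Function.support_smul_subset_right _ _)
  have hy : (Function.support fun a => y a • G a).Finite :=
    hG.subset (Function.support_smul_subset_right _ _)
  have e : (fun a => x a • G (a + 1)) =
      fun a => (fun a => x (a - 1) • G a) (Equiv.addRight (1 : ℤ) a) := by
    ext a; simp
  have hx' : (Function.support fun a => x a • G (a + 1)).Finite := by
    rw [e]
    exact hx.preimage (Equiv.injective _).injOn
  have h : ∑ᶠ a, x a • G (a + 1) = ∑ᶠ a, x (a - 1) • G a := by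
    rw [e]
    exact finsum_comp_equiv (Equiv.addRight (1 : ℤ)) (f := fun a => x (a - 1) • G a)
  rw [finsum_add_distrib hx' hy, h, ← finsum_add_distrib hx hy]
  exact finsum_congr fun a => (add_smul _ _ _).symm

end dp

/-! ### The quantum Weyl group element: commutation, reduction to two factors, invertibility. -/

namespace Rep
variable {V : Rep} {m : ℤ} {v : V.V}

theorem dp_E_mem (hv : v ∈ V.wt m) (a : ℤ) : dp (V.ρ E) a v ∈ V.wt (m + 2 * a) := by
  rcases lt_or_ge a 0 with h | h
  · rw [dp_of_neg _ h]; exact Submodule.zero_mem _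
  · lift a to ℕ using h
    rw [dp_natCast]
    exact Submodule.smul_mem _ _ (E_pow_mem hv a)

theorem dp_F_mem (hv : v ∈ V.wt m) (a : ℤ) : dp (V.ρ F) a v ∈ V.wt (m - 2 * a) := by
  rcases lt_or_ge a 0 with h | h
  · rw [dp_of_neg _ h]; exact Submodule.zero_mem _
  · lift a to ℕ using h
    rw [dp_natCast]
    exact Submodule.smul_mem _ _ (F_pow_mem hv a)

theorem dp_E_of_le {a : ℤ} (ha : Module.finrank 𝕂 V.V ≤ a) : dp (V.ρ E) a = 0 := by
  lift a to ℕ using by omega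
  rw [dp_natCast, V.E_pow_eq_zero (by omega), smul_zero]

theorem dp_F_of_le {a : ℤ} (ha : Module.finrank 𝕂 V.V ≤ a) : dp (V.ρ F) a = 0 := by
  lift a to ℕ using by omega
  rw [dp_natCast, V.F_pow_eq_zero (by omega), smul_zero]

theorem dp_E_F_apply (hv : v ∈ V.wt m) (a : ℤ) : dp (V.ρ E) a (V.ρ F v) =
    V.ρ F (dp (V.ρ E) a v) + qz (m + a - 1) • dp (V.ρ E) (a - 1) v := by
  rcases lt_or_ge a 0 with h | h
  · rw [dp_of_neg _ h, dp_of_neg _ (by omega : a - 1 < 0)]; simp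
  lift a to ℕ using h
  induction a with
  | zero => rw [Nat.cast_zero, dp_of_neg _ (by omega : (0 : ℤ) - 1 < 0)]; simp [dp_zero]
  | succ a ih =>
    have hne : qz (a + 1) ≠ 0 := qz_ne_zero (by omega)
    have h1 := congrArg (V.ρ E) ih
    rw [apply_dp, map_add, map_smul, apply_dp, E_F_apply (dp_E_mem hv a), apply_dp, map_smul,
      sub_add_cancel, smul_smul, add_assoc, ← add_smul, add_comm (qz (m + 2 * a)),
      add_comm _ (qz (m + 2 * a)), qz_add_mul, mul_smul, ← smul_add] at h1
    push_cast
    rw [add_sub_cancel_right, ← add_assoc, add_sub_cancel_right]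
    -- Applying `E` to the previous case produced the wanted identity multiplied by `[a + 1]`, which
    -- is nonzero.
    exact smul_right_injective _ hne h1

theorem dp_F_E_apply (hv : v ∈ V.wt m) (b : ℤ) : dp (V.ρ F) b (V.ρ E v) =
    V.ρ E (dp (V.ρ F) b v) - qz (m - b + 1) • dp (V.ρ F) (b - 1) v := by
  rcases lt_or_ge b 0 with h | h
  · rw [dp_of_neg _ h, dp_of_neg _ (by omega : b - 1 < 0)]; simp
  lift b to ℕ using h
  induction b with
  | zero => rw [Nat.cast_zero, dp_of_neg _ (by omega : (0 : ℤ) - 1 < 0)]; simp [dp_zero]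
  | succ b ih =>
    have hne : qz (b + 1) ≠ 0 := qz_ne_zero (by omega)
    have h1 := congrArg (V.ρ F) ih
    have h2 : qz (m - 2 * b) + qz (m - b + 1) * qz b = qz (b + 1) * qz (m - b) := by
      have := qz_add_mul (-m) b
      rw [show -m + 2 * (b : ℤ) = -(m - 2 * b) by ring, show -m + (b : ℤ) - 1 = -(m - b + 1) by ring,
        show -m + (b : ℤ) = -(m - b) by ring, qz_neg, qz_neg, qz_neg] at this
      linear_combination -this
    have h3 := E_F_apply (dp_F_mem hv b)
    rw [← sub_eq_iff_eq_add] at h3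
    rw [apply_dp, map_sub, map_smul, apply_dp, ← h3, apply_dp, map_smul,
      sub_add_cancel, smul_smul, sub_sub, ← add_smul, h2, mul_smul, ← smul_sub] at h1
    push_cast
    rw [add_sub_cancel_right, show m - ((b : ℤ) + 1) + 1 = m - b by ring]
    exact smul_right_injective _ hne h1

/-- The operator `v ↦ ∑ (-1)^b q^{b - ac} E^{(a)} F^{(b)} v`, summed over `b - a = m - c`. -/
def braidSum (V : Rep) (c m : ℤ) : Module.End 𝕂 V.V :=
  ∑ᶠ a : ℤ, ((-1) ^ (a + m - c) * q ^ (a + m - c - a * c)) •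
    (dp (V.ρ E) a * dp (V.ρ F) (a + m - c))

theorem finite_support_dp_E (g : ℤ → Module.End 𝕂 V.V) :
    (Function.support fun a => dp (V.ρ E) a * g a).Finite := by
  refine (Set.finite_Ico (0 : ℤ) (Module.finrank 𝕂 V.V)).subset fun a ha => ?_
  rw [Function.mem_support] at ha
  by_contra h
  rw [Set.mem_Ico, not_and_or, not_le, not_lt] at h
  rcases h with h | h
  · rw [dp_of_neg _ h, zero_mul] at ha; exact ha rfl
  · rw [dp_E_of_le h, zero_mul] at ha; exact ha rfl

theorem finite_support_smul_dp_E (x : ℤ → 𝕂) (g : ℤ → Module.End 𝕂 V.V) :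
    (Function.support fun a => x a • (dp (V.ρ E) a * g a)).Finite :=
  (finite_support_dp_E g).subset
    (Function.support_smul_subset_right x fun a => dp (V.ρ E) a * g a)

theorem finite_support_dp_E_apply (g : ℤ → Module.End 𝕂 V.V) (v : V.V) :
    (Function.support fun a => dp (V.ρ E) a (g a v)).Finite :=
  (finite_support_dp_E g).subset fun _ ha h => ha (LinearMap.congr_fun h v)

theorem map_braidSum_apply {M : Type} [AddCommGroup M] [Module 𝕂 M] (f : V.V →ₗ[𝕂] M) (c m : ℤ)
    (v : V.V) : f (braidSum V c m v) = ∑ᶠ a : ℤ, ((-1) ^ (a + m - c) * q ^ (a + m - c - a * c)) •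
      f (dp (V.ρ E) a (dp (V.ρ F) (a + m - c) v)) := by
  have h := (f ∘ₗ LinearMap.applyₗ v : Module.End 𝕂 V.V →ₗ[𝕂] M).toAddMonoidHom.map_finsum
    (finite_support_smul_dp_E (V := V) (fun a => (-1) ^ (a + m - c) * q ^ (a + m - c - a * c))
      fun a => dp (V.ρ F) (a + m - c))
  refine h.trans (finsum_congr fun a => ?_)
  simp

theorem braidSum_apply (c m : ℤ) (v : V.V) : braidSum V c m v =
    ∑ᶠ a : ℤ, ((-1) ^ (a + m - c) * q ^ (a + m - c - a * c)) •
      dp (V.ρ E) a (dp (V.ρ F) (a + m - c) v) :=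
  map_braidSum_apply LinearMap.id c m v

/-- These are the total coefficients of `G a` on the two sides of `braidSum_E_apply`, after shifting
indices. -/
theorem braidSum_coeff (c m a : ℤ) :
    (-1) ^ (a - 1 + (m + 2) - c) * q ^ (a - 1 + (m + 2) - c - (a - 1) * c) * qz (a - 1 + 1) +
      -((-1) ^ (a + (m + 2) - c) * q ^ (a + (m + 2) - c - a * c) *
        qz (m - (a + (m + 2) - c) + 1)) =
    -q ^ (2 * c - m) * (-((-1) ^ (a + 1 + m - c) * q ^ (a + 1 + m - c - (a + 1) * c) *
        qz (m - 2 * (a + 1 + m - c) + (a + 1) - 1)) +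
      (-1) ^ (a + m - c) * q ^ (a + m - c - a * c) * qz (a + m - c + 1)) := by
  have hq := q_sub_ne_zero
  have h0 := q_ne_zero
  have hA := zpow_ne_zero a q_ne_zero
  have hM := zpow_ne_zero m q_ne_zero
  have hC := zpow_ne_zero c q_ne_zero
  have hN := zpow_ne_zero (a * c) q_ne_zero
  have e1 : (-1 : 𝕂) ^ (a - 1 + (m + 2) - c) = -(-1) ^ (a + m - c) := by
    rw [show a - 1 + (m + 2) - c = a + m - c + 1 by ring, zpow_add₀ (by simp)]; simp
  have e2 : (-1 : 𝕂) ^ (a + (m + 2) - c) = (-1) ^ (a + m - c) := by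
    rw [show a + (m + 2) - c = a + m - c + 2 by ring, zpow_add₀ (by simp)]; simp
  have e3 : (-1 : 𝕂) ^ (a + 1 + m - c) = -(-1) ^ (a + m - c) := by
    rw [show a + 1 + m - c = a + m - c + 1 by ring, zpow_add₀ (by simp)]; simp
  rw [e1, e2, e3]
  generalize (-1 : 𝕂) ^ (a + m - c) = e
  simp only [qz]
  simp only [add_mul, one_mul, neg_mul, neg_add, two_mul, sub_eq_add_neg, neg_neg,
    zpow_add₀ q_ne_zero, zpow_neg, mul_add, mul_neg, zpow_ofNat]
  field_simp
  ring

/-- Moving `E` left through `F^{(b)}`, and `F` right through `E^{(a)}`, expresses both sides in the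
same vectors `G a = E^{(a)} F^{(a+m+1-c)} v`; it remains to match scalars. The rule reduces the
operator to its values on lowest weight vectors. -/
theorem braidSum_E_apply (c : ℤ) (hv : v ∈ V.wt m) : braidSum V c (m + 2) (V.ρ E v) =
    -q ^ (2 * c - m) • V.ρ F (braidSum V c m v) := by
  let G : ℤ → V.V := fun a => dp (V.ρ E) a (dp (V.ρ F) (a + m + 1 - c) v)
  have hG : G.support.Finite := finite_support_dp_E_apply (fun a => dp (V.ρ F) (a + m + 1 - c)) v
  have h1 : ∀ a : ℤ, ((-1) ^ (a + (m + 2) - c) * q ^ (a + (m + 2) - c - a * c)) •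
      dp (V.ρ E) a (dp (V.ρ F) (a + (m + 2) - c) (V.ρ E v)) =
      ((-1) ^ (a + (m + 2) - c) * q ^ (a + (m + 2) - c - a * c) * qz (a + 1)) • G (a + 1) +
      (-((-1) ^ (a + (m + 2) - c) * q ^ (a + (m + 2) - c - a * c) *
        qz (m - (a + (m + 2) - c) + 1))) • G a := by
    intro a
    simp only [G]
    rw [dp_F_E_apply hv, map_sub, map_smul, dp_apply, smul_sub, smul_smul, smul_smul, neg_smul,
      ← sub_eq_add_neg, show a + (m + 2) - c - 1 = a + m + 1 - c by ring,
      show a + 1 + m + 1 - c = a + (m + 2) - c by ring]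
  let H : ℤ → V.V := fun a =>
    ((-1) ^ (a + 1 + m - c) * q ^ (a + 1 + m - c - (a + 1) * c) *
        qz (a + 1 + m - c + 1)) • G (a + 1) +
      (-((-1) ^ (a + 1 + m - c) * q ^ (a + 1 + m - c - (a + 1) * c) *
        qz (m - 2 * (a + 1 + m - c) + (a + 1) - 1))) • G a
  have h2 : ∀ a : ℤ, ((-1) ^ (a + m - c) * q ^ (a + m - c - a * c)) •
      V.ρ F (dp (V.ρ E) a (dp (V.ρ F) (a + m - c) v)) = H (a - 1) := by
    intro a
    simp only [H, G, sub_add_cancel]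
    have h3 := dp_E_F_apply (dp_F_mem hv (a + m - c)) a
    rw [← sub_eq_iff_eq_add] at h3
    rw [← h3, apply_dp, map_smul, smul_sub, smul_smul, smul_smul, neg_smul, ← sub_eq_add_neg,
      show a - 1 + m + 1 - c = a + m - c by ring, show a + m - c + 1 = a + m + 1 - c by ring]
  rw [braidSum_apply, map_braidSum_apply, finsum_congr h1, finsum_congr h2]
  rw [show ∑ᶠ a, H (a - 1) = ∑ᶠ a, H a from finsum_comp_equiv (Equiv.subRight (1 : ℤ)),
    finsum_smul_shift hG, finsum_smul_shift hG, smul_finsum]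
  refine finsum_congr fun a => ?_
  rw [smul_smul, braidSum_coeff]
  congr 2
  simp only [sub_add_cancel]
  ring

theorem braidSum_E_pow_apply {n : ℤ} {u : V.V} (hu : u ∈ V.wt (-n)) (c : ℤ) (k : ℕ) :
    ∃ d : 𝕂, d ≠ 0 ∧ braidSum V c (-n + 2 * k) ((V.ρ E ^ k) u) =
      d • (V.ρ F ^ k) (braidSum V c (-n) u) := by
  induction k with
  | zero => exact ⟨1, one_ne_zero, by simp⟩
  | succ k ih =>
    obtain ⟨d, hd, h⟩ := ih
    refine ⟨-q ^ (2 * c - (-n + 2 * k)) * d, mul_ne_zero (neg_ne_zero.2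
      (zpow_ne_zero _ q_ne_zero)) hd, ?_⟩
    rw [pow_succ', pow_succ', Module.End.mul_apply, Module.End.mul_apply,
      show -n + 2 * ((k + 1 : ℕ) : ℤ) = -n + 2 * k + 2 by push_cast; ring,
      braidSum_E_apply c (E_pow_mem hu k), h, map_smul, smul_smul]

theorem dp_apply_eq_zero {M : Type} [AddCommGroup M] [Module 𝕂 M] {f : Module.End 𝕂 M} {v : M}
    (h : f v = 0) {b : ℤ} (hb : b ≠ 0) : dp f b v = 0 := by
  have h1 := dp_apply f (b - 1) v
  rw [h, map_zero, sub_add_cancel, eq_comm, smul_eq_zero] at h1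
  exact h1.resolve_left (qz_ne_zero hb)

theorem braidSum_lowest {n : ℤ} {u : V.V} (hF : V.ρ F u = 0) (c : ℤ) :
    braidSum V c (-n) u = q ^ (-((n + c) * c)) • dp (V.ρ E) (n + c) u := by
  rw [braidSum_apply, finsum_eq_single _ (n + c)]
  · simp [dp_zero]
  · intro a ha
    rw [dp_apply_eq_zero hF (by omega), map_zero, smul_zero]

theorem weightProj_apply (hv : v ∈ V.wt m) (k : ℤ) :
    (weightProj k).1 V v = if k = m then v else 0 := by
  rw [weightProj, weightDiag_apply _ _ _ _ hv, Pi.single_apply]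
  by_cases h : m = k
  · rw [if_pos h, if_pos h.symm, one_smul]
  · rw [if_neg h, if_neg (Ne.symm h), zero_smul]

/-- On `E ^ k u`, with `u` a lowest weight vector of weight `-n`, the operator gives a multiple of
`F ^ k E^{(n+c)} u`. For `c > 0` this is zero, since the string through `u` ends at `E ^ n u`. -/
theorem braidSum_eq_zero {c : ℕ} (hc : c ≠ 0) (hv : v ∈ V.wt m) : braidSum V c m v = 0 := by
  -- The operator depends on the weight; composing with weight projections turns the claim for all
  -- weights into one about a single subspace, to which the spanning lemma applies.
  have h : ⨅ k : ℤ, LinearMap.ker (braidSum V c k * (weightProj k).1 V) = ⊤ := by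
    refine eq_top_of_lowest _ fun n k _ u hu hF => ?_
    rw [Submodule.mem_iInf]
    intro l
    rw [LinearMap.mem_ker, Module.End.mul_apply, weightProj_apply (E_pow_mem hu k)]
    split_ifs with hl
    · subst hl
      obtain ⟨d, -, hd⟩ := braidSum_E_pow_apply hu c k
      rw [hd, braidSum_lowest hF, ← Nat.cast_add, dp_natCast, LinearMap.smul_apply,
        E_pow_lowest_eq_zero hu hF (by omega)]
      simp
    · rw [map_zero]
  have hv' : v ∈ ⨅ k : ℤ, LinearMap.ker (braidSum V c k * (weightProj k).1 V) := by
    rw [h]; trivial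
  have := (Submodule.mem_iInf _).1 hv' m
  rwa [LinearMap.mem_ker, Module.End.mul_apply, weightProj_apply hv, if_pos rfl] at this

theorem braidSum_eq_sum (c m : ℤ) (v : V.V) : braidSum V c m v =
    ∑ a ∈ Finset.range (Module.finrank 𝕂 V.V), ((-1) ^ (a + m - c) * q ^ (a + m - c - a * c)) •
      dp (V.ρ E) a (dp (V.ρ F) (a + m - c) v) := by
  rw [braidSum_apply, finsum_eq_sum_of_support_subset
    (s := (Finset.range (Module.finrank 𝕂 V.V)).map Nat.castEmbedding), Finset.sum_map]
  · rfl
  · intro a ha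
    rw [Finset.mem_coe, Finset.mem_map]
    rw [Function.mem_support] at ha
    by_contra h
    apply ha
    rcases lt_or_ge a 0 with h0 | h0
    · rw [dp_of_neg _ h0, LinearMap.zero_apply, smul_zero]
    · lift a to ℕ using h0
      rw [dp_E_of_le, LinearMap.zero_apply, smul_zero]
      by_contra h1
      exact h ⟨a, by rw [Finset.mem_range]; omega, rfl⟩

theorem braidTerm_apply (a b c : ℕ) (v : V.V) : V.ρ (braidTerm a b c) v =
    ((-1) ^ (b : ℤ) * q ^ ((b : ℤ) - a * c)) •
      dp (V.ρ E) a (dp (V.ρ F) b (dp (V.ρ E) c v)) := by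
  simp [braidTerm, divPow, dp_natCast]

/-- Terms are grouped by `c`: the vector `E^{(c)} v` has weight `m + 2c`, and `b = a + m + c` is
determined by `a` and `c`. -/
theorem T_apply_eq_sum (hv : v ∈ V.wt m) : T.1 V v =
    ∑ c ∈ Finset.range (Module.finrank 𝕂 V.V),
      braidSum V c (m + 2 * c) (dp (V.ρ E) c v) := by
  have h : T.1 V = ∑ p ∈ Finset.range (Module.finrank 𝕂 V.V) ×ˢ
      Finset.range (Module.finrank 𝕂 V.V) ×ˢ Finset.range (Module.finrank 𝕂 V.V),
      V.ρ (braidTerm p.1 p.2.1 p.2.2) * (weightProj ((p.2.1 : ℤ) - p.1 - p.2.2)).1 V := by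
    refine finsum_eq_sum_of_support_subset _ fun p hp => ?_
    by_contra hB
    apply hp
    simp only [Finset.coe_product, Set.mem_prod, Finset.mem_coe, Finset.mem_range] at hB
    dsimp only
    rw [braidTerm_eq_zero V _ _ _ _ le_rfl (by omega), zero_mul]
  rw [h, LinearMap.sum_apply, Finset.sum_product, Finset.sum_congr rfl fun a _ =>
    Finset.sum_product_right _ _ _, Finset.sum_comm]
  refine Finset.sum_congr rfl fun c _ => ?_
  rw [braidSum_eq_sum]
  refine Finset.sum_congr rfl fun a _ => ?_
  simp only [Module.End.mul_apply, weightProj_apply hv]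
  by_cases hb : ∃ b : ℕ, b < Module.finrank 𝕂 V.V ∧ (b : ℤ) - a - c = m
  · obtain ⟨b, hb, hm⟩ := hb
    rw [Finset.sum_eq_single b, if_pos hm, braidTerm_apply,
      show (a : ℤ) + (m + 2 * c) - c = b by omega]
    · intro b' _ hb'
      rw [if_neg (by omega), map_zero]
    · intro h
      exact absurd (Finset.mem_range.2 hb) h
  · rw [Finset.sum_eq_zero]
    · rcases lt_or_ge ((a : ℤ) + (m + 2 * c) - c) 0 with h0 | h0
      · rw [dp_of_neg (V.ρ F) h0, LinearMap.zero_apply, map_zero, smul_zero]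
      · rw [dp_F_of_le, LinearMap.zero_apply, map_zero, smul_zero]
        by_contra h1
        exact hb ⟨((a : ℤ) + (m + 2 * c) - c).toNat, by omega, by omega⟩
    · intro b hb'
      rw [if_neg fun h => hb ⟨b, Finset.mem_range.1 hb', h⟩, map_zero]

theorem T_apply (hv : v ∈ V.wt m) : T.1 V v = braidSum V 0 m v := by
  rw [T_apply_eq_sum hv]
  rcases Nat.eq_zero_or_pos (Module.finrank 𝕂 V.V) with h | h
  · have := Module.finrank_zero_iff.1 h
    exact Subsingleton.elim _ _
  · rw [Finset.sum_eq_single 0]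
    · simp [dp_zero]
    · intro c _ hc
      exact braidSum_eq_zero hc (dp_E_mem hv c)
    · intro h'
      exact absurd (Finset.mem_range.2 h) h'

theorem T_mem (hv : v ∈ V.wt m) : T.1 V v ∈ V.wt (-m) := by
  rw [T_apply hv, braidSum_eq_sum]
  refine Submodule.sum_mem _ fun a _ => Submodule.smul_mem _ _ ?_
  have := dp_E_mem (dp_F_mem hv (a + m - 0)) a
  convert this using 2
  ring

theorem T_E_apply (hv : v ∈ V.wt m) : T.1 V (V.ρ E v) = -q ^ (-m) • V.ρ F (T.1 V v) := by
  rw [T_apply hv, T_apply (E_mem hv), braidSum_E_apply 0 hv]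
  simp

theorem T_lowest {n : ℤ} {u : V.V} (hu : u ∈ V.wt (-n)) (hF : V.ρ F u = 0) :
    T.1 V u = dp (V.ρ E) n u := by
  rw [T_apply hu, braidSum_lowest hF]
  simp

/-- By finite dimension surjectivity suffices. With `w` of highest weight `n`, `F ^ n w` is a lowest
weight vector, and `T` sends `E ^ k F ^ n w` to a nonzero multiple of `F ^ k w`. -/
theorem T_injective (V : Rep) : Function.Injective (T.1 V) := by
  rw [LinearMap.injective_iff_surjective, ← LinearMap.range_eq_top]
  refine eq_top_of_highest _ fun n k _ w hw => ?_
  have hu : (V.ρ F ^ n) w ∈ V.wt (-n) := by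
    convert F_pow_mem hw.mem n using 2; ring
  have hF : V.ρ F ((V.ρ F ^ n) w) = 0 := by
    rw [← Module.End.mul_apply, ← pow_succ', hw.F_pow_eq_zero (Nat.lt_succ_self n)]
  obtain ⟨d, hd, h⟩ := braidSum_E_pow_apply hu 0 k
  obtain ⟨e, he, h'⟩ := hw.exists_E_pow le_rfl
  rw [← T_apply hu, T_lowest hu hF, dp_natCast, LinearMap.smul_apply, h', map_smul, map_smul,
    smul_smul, smul_smul, ← T_apply (E_pow_mem hu k)] at h
  refine ((LinearMap.range (T.1 V)).smul_mem_iff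
    (mul_ne_zero (mul_ne_zero hd (inv_ne_zero (qFactorial_ne_zero n))) he)).1 ?_
  exact ⟨_, h⟩

end Rep

/-! ### The element `X`, its twists and its square. -/

theorem weightDiag_mul (f g : ℤ → 𝕂) : weightDiag f * weightDiag g = weightDiag (f * g) := by
  refine Subtype.ext (funext fun V => Rep.ext_wt fun m v hv => ?_)
  change (weightDiag f).1 V ((weightDiag g).1 V v) = _
  rw [weightDiag_apply g V m v hv, map_smul, weightDiag_apply f V m v hv,
    weightDiag_apply (f * g) V m v hv, smul_smul, Pi.mul_apply, mul_comm]

theorem weightDiag_one : weightDiag 1 = 1 := by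
  refine Subtype.ext (funext fun V => Rep.ext_wt fun m v hv => ?_)
  rw [weightDiag_apply 1 V m v hv, Pi.one_apply, one_smul]
  rfl

theorem isUnit_J : IsUnit J := by
  have h : (fun m : ℤ => s ^ (m ^ 2 + 2 * m)) * (fun m : ℤ => (s ^ (m ^ 2 + 2 * m))⁻¹) = 1 :=
    funext fun m => mul_inv_cancel₀ (zpow_ne_zero _ s_ne_zero)
  refine ⟨⟨J, weightDiag fun m => (s ^ (m ^ 2 + 2 * m))⁻¹, ?_, ?_⟩, rfl⟩
  · rw [J, weightDiag_mul, h, weightDiag_one]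
  · rw [J, weightDiag_mul, mul_comm, h, weightDiag_one]

theorem isUnit_X : IsUnit X := isUnit_J.mul (isUnit_of_injective T Rep.T_injective)

theorem X_apply {V : Rep} {m : ℤ} {v : V.V} (hv : v ∈ V.wt m) :
    X.1 V v = s ^ (m ^ 2 - 2 * m) • T.1 V v := by
  change J.1 V (T.1 V v) = _
  -- `J` acts after `T`, hence at weight `-m`; this is the source of the sign in the exponent.
  rw [J, weightDiag_apply _ V (-m) _ (Rep.T_mem hv)]
  congr 2; ring

theorem X_mem {V : Rep} {m : ℤ} {v : V.V} (hv : v ∈ V.wt m) : X.1 V v ∈ V.wt (-m) := by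
  rw [X_apply hv]
  exact Submodule.smul_mem _ _ (Rep.T_mem hv)

theorem X_mul_Ktwist (a : 𝕂ˣ) : X * Ktwist a = Ktwist a⁻¹ * X := by
  refine Subtype.ext (funext fun V => Rep.ext_wt fun m v hv => ?_)
  change X.1 V ((Ktwist a).1 V v) = (Ktwist a⁻¹).1 V (X.1 V v)
  rw [Ktwist, Ktwist, weightDiag_apply _ V m v hv, weightDiag_apply _ V (-m) _ (X_mem hv),
    map_smul]
  simp

theorem Ktwist_inv_mul (a : 𝕂ˣ) : Ktwist a⁻¹ * Ktwist a = 1 := by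
  rw [Ktwist, Ktwist, weightDiag_mul, ← weightDiag_one]
  congr 1
  funext m
  simp only [Pi.mul_apply, Pi.one_apply, inv_zpow, ← Units.val_mul, inv_mul_cancel, Units.val_one]

theorem X_mul_Ktwist_sq (a : 𝕂ˣ) : (X * Ktwist a) ^ 2 = X ^ 2 := by
  have h : Ktwist a * X = X * Ktwist a⁻¹ := by rw [X_mul_Ktwist, inv_inv]
  rw [pow_two, pow_two, mul_assoc, ← mul_assoc (Ktwist a), h, mul_assoc, Ktwist_inv_mul, mul_one]

theorem T_vMinus : T.1 Rep.std Rep.vMinus = Rep.vPlus := by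
  rw [Rep.T_lowest Rep.vMinus_mem Rep.std_F_vMinus]
  have := dp_natCast (Rep.std.ρ E) 1
  rw [Nat.cast_one] at this
  rw [this, LinearMap.smul_apply, pow_one, Rep.std_E_vMinus, qFactorial_succ]
  simp [qFactorial]

theorem T_vPlus : T.1 Rep.std Rep.vPlus = -q • Rep.vMinus := by
  rw [← Rep.std_E_vMinus, Rep.T_E_apply Rep.vMinus_mem, T_vMinus, Rep.std_F_vPlus, neg_neg,
    zpow_one]

theorem X_vMinus : X.1 Rep.std Rep.vMinus = s ^ 3 • Rep.vPlus := by
  rw [X_apply Rep.vMinus_mem, T_vMinus]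
  norm_num

theorem X_vPlus : X.1 Rep.std Rep.vPlus = -s ^ 3 • Rep.vMinus := by
  rw [X_apply Rep.vPlus_mem, T_vPlus, smul_smul]
  congr 1
  norm_num
  rw [q]
  field_simp [s_ne_zero]

/-- `X` exchanges the two weight lines with scalars `-s³` and `s³`. The minus sign, inherited from
`T E v = -q^{-m} F T v`, is what excludes the standard ribbon element. -/
theorem X_sq_std : (X ^ 2).1 Rep.std = -s ^ 6 • (1 : Module.End 𝕂 Rep.std.V) := by
  refine LinearMap.ext fun u => ?_
  change X.1 Rep.std (X.1 Rep.std u) = -s ^ 6 • u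
  rw [Rep.std_decomp u, map_add, map_add, map_smul, map_smul, map_smul, map_smul, X_vPlus,
    X_vMinus, map_smul, map_smul, X_vPlus, X_vMinus]
  rw [smul_add, smul_smul, smul_smul, smul_smul, smul_smul, smul_smul, smul_smul]
  congr 2 <;> ring

/-! ### Group-like elements of the completion. -/

theorem Ktwist_tensor (a : 𝕂ˣ) (V W : Rep) : (Ktwist a).1 (V.tensor W) =
    TensorProduct.map ((Ktwist a).1 V) ((Ktwist a).1 W) := by
  refine TensorProduct.ext (Rep.ext_wt fun m v hv => Rep.ext_wt fun n w hw => ?_)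
  change (Ktwist a).1 (V.tensor W) (v ⊗ₜ w) = (Ktwist a).1 V v ⊗ₜ (Ktwist a).1 W w
  rw [Ktwist, weightDiag_apply _ _ _ _ (Rep.tensor_mem_wt hv hw), weightDiag_apply _ V m v hv,
    weightDiag_apply _ W n w hw, TensorProduct.smul_tmul_smul, zpow_add, Units.val_mul]

theorem Ktwist_triv (a : 𝕂ˣ) : (Ktwist a).1 Rep.triv = 1 := by
  refine LinearMap.ext_ring ?_
  have := weightDiag_apply (fun m => ((a ^ m : 𝕂ˣ) : 𝕂)) Rep.triv 0 (1 : 𝕂)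
    Rep.isHighest_triv.mem
  rw [Ktwist, this]
  simp

/-- If `g` acts by `c` on the trivial representation, it acts by `c` on its tensor square, which
also has a highest weight vector of weight 0. Multiplicativity gives `c² = c`, and `c ≠ 0` because
`g` is invertible. -/
theorem counit_of_grouplike {g : completion} (hg : IsUnit g)
    (h : ∀ V W : Rep, g.1 (V.tensor W) = TensorProduct.map (g.1 V) (g.1 W)) :
    g.1 Rep.triv = 1 := by
  obtain ⟨c, hc⟩ : ∃ c : 𝕂, g.1 Rep.triv (1 : 𝕂) = c • (1 : 𝕂) :=
    ⟨g.1 Rep.triv (1 : 𝕂), by simp⟩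
  have h0 : c ≠ 0 := by
    rintro rfl
    obtain ⟨u, rfl⟩ := hg
    have h1 := congrArg (fun a : completion => a.1 Rep.triv (1 : 𝕂)) u.inv_mul
    have h2 : (u⁻¹ : completionˣ).1.1 Rep.triv (u.1.1 Rep.triv (1 : 𝕂)) = (1 : 𝕂) := h1
    rw [hc, zero_smul, map_zero] at h2
    exact zero_ne_one h2
  have h1 := completion_apply_highest g Rep.isHighest_triv one_ne_zero
    (Rep.isHighest_triv.tensor Rep.isHighest_triv) hc
  rw [h, TensorProduct.map_tmul, hc] at h1
  have h2 := congrArg (TensorProduct.lid 𝕂 𝕂) h1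
  rw [map_smul, TensorProduct.lid_tmul, TensorProduct.lid_tmul] at h2
  have h3 : c = 1 := by
    simp only [smul_eq_mul, mul_one] at h2
    exact mul_left_cancel₀ h0 (h2.trans (mul_one c).symm)
  refine LinearMap.ext_ring ?_
  rw [hc, h3, one_smul]
  rfl

/-- The invariant vector in the tensor square of the standard representation. -/
theorem isHighest_invariant : (Rep.std.tensor Rep.std).IsHighest 0
    (Rep.vPlus ⊗ₜ Rep.vMinus - q⁻¹ • Rep.vMinus ⊗ₜ Rep.vPlus) where
  mem := by
    have h1 := Rep.tensor_mem_wt Rep.vPlus_mem Rep.vMinus_mem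
    have h2 := Rep.tensor_mem_wt Rep.vMinus_mem Rep.vPlus_mem
    rw [add_neg_cancel] at h1
    rw [neg_add_cancel] at h2
    rw [Nat.cast_zero]
    exact Submodule.sub_mem _ h1 (Submodule.smul_mem _ _ h2)
  E_apply := by
    rw [map_sub, map_smul, Rep.tensor_E_apply, Rep.tensor_E_apply, Rep.std_E_vPlus,
      Rep.std_E_vMinus, Rep.K_two_apply Rep.vPlus_mem, zpow_one, TensorProduct.zero_tmul,
      TensorProduct.tmul_zero, zero_add, add_zero, TensorProduct.tmul_smul, smul_smul,
      inv_mul_cancel₀ q_ne_zero, one_smul, sub_self]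

/-- The matrix coefficients of a vector in the tensor square of the standard representation. -/
def stdCoeff (i j : Fin 2) : Rep.std.V ⊗[𝕂] Rep.std.V →ₗ[𝕂] 𝕂 :=
  (TensorProduct.lid 𝕂 𝕂).toLinearMap ∘ₗ TensorProduct.map
    (LinearMap.proj i : (Fin 2 → 𝕂) →ₗ[𝕂] 𝕂) (LinearMap.proj j : (Fin 2 → 𝕂) →ₗ[𝕂] 𝕂)

theorem stdCoeff_tmul (i j : Fin 2) (v w : Rep.std.V) : stdCoeff i j (v ⊗ₜ w) = v i * w j := by
  simp [stdCoeff]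

theorem eq_Ktwist_of_grouplike {g : completion} (hg : IsUnit g)
    (h : ∀ V W : Rep, g.1 (V.tensor W) = TensorProduct.map (g.1 V) (g.1 W)) :
    ∃ a : 𝕂ˣ, g = Ktwist a := by
  have htriv := counit_of_grouplike hg h
  have h1 := completion_apply_highest g (c := 1) Rep.isHighest_triv one_ne_zero
    isHighest_invariant (by rw [htriv, one_smul]; rfl)
  rw [h, one_smul, map_sub, map_smul, TensorProduct.map_tmul, TensorProduct.map_tmul] at h1
  have hc : ∀ i j, g.1 Rep.std Rep.vPlus i * g.1 Rep.std Rep.vMinus j -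
      q⁻¹ * (g.1 Rep.std Rep.vMinus i * g.1 Rep.std Rep.vPlus j) =
      Rep.vPlus i * Rep.vMinus j - q⁻¹ * (Rep.vMinus i * Rep.vPlus j) := by
    intro i j
    have := congrArg (stdCoeff i j) h1
    rw [map_sub, map_sub, map_smul, map_smul] at this
    erw [stdCoeff_tmul, stdCoeff_tmul, stdCoeff_tmul, stdCoeff_tmul] at this
    exact this
  have h00 := hc 0 0
  have h01 := hc 0 1
  have h10 := hc 1 0
  have h11 := hc 1 1
  have hp := Rep.std_decomp (g.1 Rep.std Rep.vPlus)
  have hm := Rep.std_decomp (g.1 Rep.std Rep.vMinus)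
  generalize g.1 Rep.std Rep.vPlus 0 = α at *
  generalize g.1 Rep.std Rep.vPlus 1 = γ at *
  generalize g.1 Rep.std Rep.vMinus 0 = β at *
  generalize g.1 Rep.std Rep.vMinus 1 = δ at *
  simp only [Pi.single_eq_same, ne_eq, zero_ne_one, one_ne_zero, not_false_eq_true,
    Pi.single_eq_of_ne, mul_zero, mul_one, sub_zero, zero_sub, sub_self] at h00 h01 h10 h11
  -- `(α, γ)` and `(β, δ)` are the coordinates of `g v₊` and `g v₋`. The four coefficients of the
  -- fixed invariant vector give `αβ = γδ = γβ = 0` and `αδ = 1`, because neither `q` nor `q²` is 1.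
  have hq1 : 1 - q⁻¹ ≠ 0 := by
    intro h
    have := @q_zpow_injective 0 (-1) (by simpa [sub_eq_zero] using h)
    omega
  have hq2 : 1 - q⁻¹ ^ 2 ≠ 0 := by
    intro h
    have := @q_zpow_injective 0 (-2) (by
      simpa [sub_eq_zero, zpow_neg] using h)
    omega
  have e1 : α * β = 0 := by
    refine (mul_eq_zero.1 ?_).resolve_left hq1
    linear_combination h00
  have e2 : γ * δ = 0 := by
    refine (mul_eq_zero.1 ?_).resolve_left hq1
    linear_combination h11
  have e3 : γ * β = 0 := by
    refine (mul_eq_zero.1 ?_).resolve_left hq2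
    linear_combination h10 + q⁻¹ * h01
  have e4 : α * δ = 1 := by linear_combination h01 + q⁻¹ * e3
  have hα : α ≠ 0 := left_ne_zero_of_mul_eq_one e4
  have hδ : δ ≠ 0 := right_ne_zero_of_mul_eq_one e4
  rw [(mul_eq_zero.1 e2).resolve_right hδ, zero_smul, add_zero] at hp
  rw [(mul_eq_zero.1 e1).resolve_left hα, zero_smul, zero_add] at hm
  refine ⟨Units.mk0 α hα, ?_⟩
  have hstd : g.1 Rep.std = (Ktwist (Units.mk0 α hα)).1 Rep.std := by
    refine LinearMap.ext fun u => ?_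
    rw [Rep.std_decomp u, map_add, map_add, map_smul, map_smul, map_smul, map_smul, hp, hm,
      Ktwist, weightDiag_apply _ _ _ _ Rep.vPlus_mem, weightDiag_apply _ _ _ _ Rep.vMinus_mem,
      eq_inv_of_mul_eq_one_right e4]
    simp
  refine completion_ext Rep.stdPow _ Rep.isHighest_stdPowHighest Rep.stdPowHighest_ne_zero
    fun n => ?_
  induction n with
  | zero => exact htriv.trans (Ktwist_triv _).symm
  | succ n ih =>
    change g.1 ((Rep.stdPow n).tensor Rep.std) = (Ktwist _).1 ((Rep.stdPow n).tensor Rep.std)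
    rw [h, Ktwist_tensor, ih, hstd]

/-! ### Half-ribbon elements with a common R-matrix. -/

theorem comulHat_mul (a b : completion) : comulHat (a * b) = comulHat a * comulHat b := rfl

theorem tmulHat_mul (a b c d : completion) :
    tmulHat (a * b) (c * d) = tmulHat a c * tmulHat b d :=
  Subtype.ext (funext fun _ => funext fun _ => TensorProduct.map_mul _ _ _ _)

theorem tmulHat_one : tmulHat 1 1 = 1 :=
  Subtype.ext (funext fun _ => funext fun _ => TensorProduct.map_id)

theorem tmulHat_mul_rMatrix (t : completionˣ) : tmulHat t t * rMatrix t = comulHat t := by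
  rw [rMatrix, ← mul_assoc, ← tmulHat_mul, t.mul_inv, tmulHat_one, one_mul]

theorem grouplike_of_rMatrix_eq {t x : completionˣ} (h : rMatrix t = rMatrix x)
    (hR : IsQuasitriangular (rMatrix x)) (V W : Rep) :
    ((x⁻¹ * t : completionˣ) : completion).1 (V.tensor W) = TensorProduct.map
      (((x⁻¹ * t : completionˣ) : completion).1 V) (((x⁻¹ * t : completionˣ) : completion).1 W) := by
  set g : completionˣ := x⁻¹ * t
  have ht : t = x * g := by simp [g]
  have h1 : tmulHat t t * rMatrix x = tmulHat x x * (rMatrix x * comulHat g) := by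
    rw [← h, tmulHat_mul_rMatrix, ← mul_assoc, h, tmulHat_mul_rMatrix, ← comulHat_mul,
      ← Units.val_mul, ← ht]
  rw [ht, Units.val_mul, tmulHat_mul, mul_assoc] at h1
  -- `Δ(t) = (t ⊗ t) R_t` is expanded with `t = x g` and the factor `x ⊗ x` is cancelled.
  have h2 : tmulHat g g * rMatrix x = rMatrix x * comulHat g := by
    have h3 := congrArg (tmulHat ↑x⁻¹ ↑x⁻¹ * ·) h1
    simpa only [← mul_assoc, ← tmulHat_mul, x.inv_mul, tmulHat_one, one_mul] using h3
  obtain ⟨r, hr⟩ := hR.isUnit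
  have h4 : (tmulHat g g).1 * (rMatrix x).1 = flip₂ (comulHat g).1 * (rMatrix x).1 := by
    rw [← hR.comul_op g]
    exact congrArg Subtype.val h2
  have h5 : (rMatrix x).1 * (↑r⁻¹ : completion₂).1 = 1 := by
    rw [← hr]
    exact congrArg Subtype.val r.mul_inv
  have h6 : (tmulHat g g).1 = flip₂ (comulHat g).1 := by
    have := congrArg (· * (↑r⁻¹ : completion₂).1) h4
    simpa only [mul_assoc, h5, mul_one] using this
  -- The identity obtained involves the opposite coproduct; evaluating it at the swapped pair and
  -- undoing the flip gives the coproduct itself.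
  have h7 : TensorProduct.map (g.1.1 W) (g.1.1 V) =
      (TensorProduct.comm 𝕂 V.V W.V).conj (g.1.1 (V.tensor W)) := congrFun (congrFun h6 W) V
  refine TensorProduct.ext' fun v w => ?_
  have h8 := LinearMap.congr_fun h7 (w ⊗ₜ v)
  rw [LinearEquiv.conj_apply_apply, TensorProduct.comm_symm_tmul, TensorProduct.map_tmul] at h8
  have h9 := congrArg (TensorProduct.comm 𝕂 V.V W.V).symm h8
  rw [LinearEquiv.symm_apply_apply, TensorProduct.comm_symm_tmul] at h9
  rw [TensorProduct.map_tmul]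
  exact h9.symm

theorem IsHalfRibbon.exists_eq_mul_Ktwist {x t : completionˣ} (ht : IsHalfRibbon (rMatrix x) t) :
    ∃ a : 𝕂ˣ, (t : completion) = x * Ktwist a := by
  -- Quasi-triangularity of `R_x` is extracted from `t`, as `R_t = R_x`.
  have hR := ht.ribbon.quasitriangular
  rw [ht.rMatrix_eq] at hR
  obtain ⟨a, ha⟩ := eq_Ktwist_of_grouplike (x⁻¹ * t).isUnit
    (grouplike_of_rMatrix_eq ht.rMatrix_eq hR)
  exact ⟨a, by rw [← ha, ← Units.val_mul, mul_inv_cancel_left]⟩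

theorem IsHalfRibbon.inv_sq_eq {x t : completionˣ} (hx : (x : completion) = X)
    (ht : IsHalfRibbon (rMatrix x) t) : t⁻¹ ^ 2 = x⁻¹ ^ 2 := by
  obtain ⟨a, ha⟩ := ht.exists_eq_mul_Ktwist
  rw [inv_pow, inv_pow]
  congr 1
  refine Units.ext ?_
  rw [Units.val_pow_eq_pow_val, Units.val_pow_eq_pow_val, ha, hx, X_mul_Ktwist_sq]

theorem inv_sq_std {x : completionˣ} (hx : (x : completion) = X) {c : completion}
    (hc : IsStandardRibbonElement c) :
    ((x⁻¹ ^ 2 : completionˣ) : completion).1 Rep.std = -c.1 Rep.std := by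
  have h1 : ((x⁻¹ ^ 2 : completionˣ) : completion) * X ^ 2 = 1 := by
    rw [← hx, ← Units.val_pow_eq_pow_val, ← Units.val_mul, inv_pow, inv_mul_cancel, Units.val_one]
  have h2 : ((x⁻¹ ^ 2 : completionˣ) : completion).1 Rep.std * (X ^ 2).1 Rep.std = 1 :=
    congrArg (fun a : completion => a.1 Rep.std) h1
  rw [X_sq_std, mul_smul_comm, mul_one] at h2
  rw [hc.std, ← h2, smul_smul, ← neg_smul]
  have h3 : -(s ^ (-6 : ℤ) * -s ^ 6) = 1 := by
    rw [mul_neg, neg_neg, zpow_neg]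
    exact inv_mul_cancel₀ (pow_ne_zero 6 s_ne_zero)
  rw [neg_mul_eq_neg_mul, ← neg_mul_eq_neg_mul, h3, one_smul]

/-- The scalar `s⁻⁶` is nonzero and the characteristic is not 2. -/
theorem IsStandardRibbonElement.std_ne_neg {c : completion} (hc : IsStandardRibbonElement c) :
    c.1 Rep.std ≠ -c.1 Rep.std := by
  intro h
  have h1 := congrFun (LinearMap.congr_fun h Rep.vPlus) 0
  rw [hc.std] at h1
  simp [self_eq_neg, s_ne_zero] at h1

end QSl2
end

theorem mainTheorem3 :
    ∃ (X : QSl2.completionˣ) (C : QSl2.completion),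
      (X : QSl2.completion) = QSl2.X ∧
      (∀ c : QSl2.completion, QSl2.IsStandardRibbonElement c ↔ c = C) ∧
      (¬ ∃ t : QSl2.completionˣ, QSl2.IsHalfRibbon (QSl2.rMatrix X) t ∧
        ((t⁻¹ ^ 2 : QSl2.completionˣ) : QSl2.completion) = C) ∧
      (∀ t : QSl2.completionˣ, QSl2.IsHalfRibbon (QSl2.rMatrix X) t →
        ∃ a : QSl2.𝕂ˣ, (t : QSl2.completion) = X * QSl2.Ktwist a) ∧
      (∀ t : QSl2.completionˣ, QSl2.IsHalfRibbon (QSl2.rMatrix X) t → t⁻¹ ^ 2 = X⁻¹ ^ 2) ∧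
      ((X⁻¹ ^ 2 : QSl2.completionˣ) : QSl2.completion).1 QSl2.Rep.std = -C.1 QSl2.Rep.std := by
  obtain ⟨x, hx⟩ := QSl2.isUnit_X
  obtain ⟨C, hC⟩ := QSl2.exists_standardRibbonElement
  refine ⟨x, C, hx, fun c => ⟨fun hc => hc.eq hC, fun h => h ▸ hC⟩, ?_,
    fun t ht => ht.exists_eq_mul_Ktwist, fun t ht => ht.inv_sq_eq hx, QSl2.inv_sq_std hx hC⟩
  rintro ⟨t, ht, htC⟩
  -- If `t⁻² = C`, then on the standard representation `C = t⁻² = X⁻² = -C`.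
  apply hC.std_ne_neg
  rw [← QSl2.inv_sq_std hx hC, ← ht.inv_sq_eq hx, htC]
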